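/- **Setting.** For a finite set $X$, let $\mathcal F(X)$ be the free skew field over $\mathbb Q$ on $X$ (the universal field of fractions of the free algebra $\mathbb Q\langle X\rangle$). A double bracket on a $\mathbb Q$-algebra $A$ is a $\mathbb Q$-bilinear map $\{\!\{-,-\}\!\}\colon A\times A\to A\otimes A$ with $\{\!\{a,bc\}\!\}=\{\!\{a,b\}\!\}(1\otimes c)+(b\otimes 1)\{\!\{a,c\}\!\}$ and $\{\!\{b,a\}\!\}=-\{\!\{a,b\}\!\}^{\tau}$, where $(x\otimes y)^\tau=y\otimes x$. Let $Q$ be a finite quiver with vertex set $Q_0$ and arrow set $Q_1$, with a cyclic (counter-clockwise) order of the half-edges at each vertex, in which every vertex is white (one incoming arrow, two outgoing), black (two incoming, one outgoing) or a univalent boundary vertex. Each arrow $\alpha$ has two half-edges: $\alpha_s$ at its source and $\alpha_t$ at its target. Let $\mathcal F_Q=\mathcal F(Q_1)$, for a vertex $p$ let $\mathcal F_p$ be the free skew field on the half-edges at $p$, and let $H_Q$ be the free skew field on all half-edges. Fix $w_1,w_2,w_3,k_1,k_2,k_3\in\mathbb Q$. The local double bracket on $\mathcal F_p$ is the double bracket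 that vanishes on each pair $(h,h)$, $h$ a half-edge at $p$, and satisfies: * if $p$ is white, with incoming half-edge $x$ and outgoing ones $y,z$, in counter-clockwise order $x,y,z$: $\{\!\{x,y\}\!\}=w_1(1\otimes xy)$, $\{\!\{x,z\}\!\}=w_2(1\otimes xz)$, $\{\!\{y,z\}\!\}=w_3(y\otimes z)$; * if $p$ is black, with outgoing half-edge $a$ and incoming ones $b,c$, in counter-clockwise order $a,c,b$: $\{\!\{a,b\}\!\}=k_1(ba\otimes 1)$, $\{\!\{a,c\}\!\}=k_2(ca\otimes 1)$, $\{\!\{b,c\}\!\}=k_3(c\otimes b)$; * if $p$ is a boundary vertex, it is zero. **Proposition.** The local double bracket on each $\mathcal F_p$ exists and is unique. There is a unique double bracket on $H_Q$ that restricts to the local double bracket on each $\mathcal F_p\subset H_Q$ and satisfies $\{\!\{a,b\}\!\}=0$ for $a\in\mathcal F_p$, $b\in\mathcal F_q$, $p\ne q$. Let $g^*\colon\mathcal F_Q\to H_Q$ be the homomorphism with $g^*(\alpha)=\alpha_s\alpha_t$ for $\alpha\in Q_1$. Then there is a unique double bracket on $\mathcal F_Q$ such that $$\{\!\{g^*(\alpha),g^*(\beta)\}\!\}_{H_Q}=(g^*\otimes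 g^*)\bigl(\{\!\{\alpha,\beta\}\!\}_{\mathcal F_Q}\bigr)\qquad\text{for all }\alpha,\beta\in Q_1,$$ and for this double bracket the identity holds for all $\alpha,\beta\in\mathcal F_Q$. -/

import Mathlib

open scoped TensorProduct

universe u v

/-! ### The free skew field -/

/-- A square matrix over a ring is *full* if it is not a product of an `n × m` and an `m × n` matrix
with `m < n`. -/
def IsFullMatrix {R : Type u} [Ring R] {n : ℕ} (A : Matrix (Fin n) (Fin n) R) : Prop :=
  ∀ (m : ℕ) (P : Matrix (Fin n) (Fin m) R) (S : Matrix (Fin m) (Fin n) R), A = P * S → n ≤ m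

/-- Generators of the free skew field on `X`: the variables, and the entries of a formal inverse of
every full matrix over the free algebra `ℚ⟨X⟩`. -/
inductive FreeSkewFieldGen (X : Type u) : Type u
  | var (x : X) : FreeSkewFieldGen X
  | inv (n : ℕ) (A : Matrix (Fin n) (Fin n) (FreeAlgebra ℚ X)) (hA : IsFullMatrix A)
      (i j : Fin n) : FreeSkewFieldGen X

/-- The free algebra on `X`, inside the free algebra on all the generators. -/
def FreeSkewFieldGen.ofFree (X : Type u) :
    FreeAlgebra ℚ X →ₐ[ℚ] FreeAlgebra ℚ (FreeSkewFieldGen X) :=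
  FreeAlgebra.lift ℚ fun x => FreeAlgebra.ι ℚ (FreeSkewFieldGen.var x)

/-- The relations `A * A⁻¹ = 1` and `A⁻¹ * A = 1`, entry by entry, for all full matrices `A`. -/
inductive FreeSkewFieldRel (X : Type u) :
    FreeAlgebra ℚ (FreeSkewFieldGen X) → FreeAlgebra ℚ (FreeSkewFieldGen X) → Prop
  | mul_inv (n : ℕ) (A : Matrix (Fin n) (Fin n) (FreeAlgebra ℚ X)) (hA : IsFullMatrix A)
      (i j : Fin n) : FreeSkewFieldRel X
        (∑ l, FreeSkewFieldGen.ofFree X (A i l) *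
          FreeAlgebra.ι ℚ (FreeSkewFieldGen.inv n A hA l j))
        ((1 : Matrix (Fin n) (Fin n) (FreeAlgebra ℚ (FreeSkewFieldGen X))) i j)
  | inv_mul (n : ℕ) (A : Matrix (Fin n) (Fin n) (FreeAlgebra ℚ X)) (hA : IsFullMatrix A)
      (i j : Fin n) : FreeSkewFieldRel X
        (∑ l, FreeAlgebra.ι ℚ (FreeSkewFieldGen.inv n A hA i l) *
          FreeSkewFieldGen.ofFree X (A l j))
        ((1 : Matrix (Fin n) (Fin n) (FreeAlgebra ℚ (FreeSkewFieldGen X))) i j)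

/-- The free skew field `𝓕(X)` over `ℚ`, i.e. the universal field of fractions of the free algebra
`ℚ⟨X⟩`, in Cohn's construction: the universal localization of `ℚ⟨X⟩` at all full matrices. -/
def FreeSkewField (X : Type u) : Type u := RingQuot (FreeSkewFieldRel X)

namespace FreeSkewField

noncomputable instance (X : Type u) : Ring (FreeSkewField X) :=
  inferInstanceAs (Ring (RingQuot (FreeSkewFieldRel X)))

noncomputable instance (X : Type u) : Algebra ℚ (FreeSkewField X) :=
  inferInstanceAs (Algebra ℚ (RingQuot (FreeSkewFieldRel X)))

/-- The quotient map defining `𝓕(X)`. -/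
noncomputable def mk (X : Type u) : FreeAlgebra ℚ (FreeSkewFieldGen X) →ₐ[ℚ] FreeSkewField X :=
  RingQuot.mkAlgHom ℚ (FreeSkewFieldRel X)

/-- The canonical homomorphism `ℚ⟨X⟩ → 𝓕(X)`. -/
noncomputable def ofFree (X : Type u) : FreeAlgebra ℚ X →ₐ[ℚ] FreeSkewField X :=
  (mk X).comp (FreeSkewFieldGen.ofFree X)

/-- A variable, as an element of the free skew field. -/
noncomputable def gen {X : Type u} (x : X) : FreeSkewField X :=
  ofFree X (FreeAlgebra.ι ℚ x)

/-- Extension to free skew fields of a homomorphism of free algebras which preserves full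
matrices. -/
noncomputable def map {X : Type u} {Y : Type v} (f : FreeAlgebra ℚ X →ₐ[ℚ] FreeAlgebra ℚ Y)
    (hf : ∀ (n : ℕ) (A : Matrix (Fin n) (Fin n) (FreeAlgebra ℚ X)),
      IsFullMatrix A → IsFullMatrix (A.map f)) :
    FreeSkewField X →ₐ[ℚ] FreeSkewField Y :=
  RingQuot.liftAlgHom ℚ
    ⟨FreeAlgebra.lift ℚ fun y : FreeSkewFieldGen X => match y with
      | .var x => ofFree Y (f (FreeAlgebra.ι ℚ x))
      | .inv n A hA i j => mk Y (FreeAlgebra.ι ℚ (.inv n (A.map f) (hf n A hA) i j)), by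
      have key : ∀ a : FreeAlgebra ℚ X,
          FreeAlgebra.lift ℚ (fun y : FreeSkewFieldGen X => match y with
            | .var x => ofFree Y (f (FreeAlgebra.ι ℚ x))
            | .inv n A hA i j => mk Y (FreeAlgebra.ι ℚ (.inv n (A.map f) (hf n A hA) i j)))
            (FreeSkewFieldGen.ofFree X a) = mk Y (FreeSkewFieldGen.ofFree Y (f a)) := by
        intro a
        refine DFunLike.congr_fun (f := (AlgHom.comp (FreeAlgebra.lift ℚ _)
          (FreeSkewFieldGen.ofFree X))) (g := (mk Y).comp ((FreeSkewFieldGen.ofFree Y).comp f)) ?_ a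
        ext x
        simp [FreeSkewFieldGen.ofFree, ofFree]
      intro a b h
      cases h with
      | mul_inv n A hA i j =>
        have := RingQuot.mkAlgHom_rel ℚ (FreeSkewFieldRel.mul_inv n (A.map f) (hf n A hA) i j)
        simp only [map_sum, map_mul, key, FreeAlgebra.lift_ι_apply]
        refine Eq.trans ?_ (this.trans ?_)
        · simp [mk]
          rfl
        · by_cases hij : i = j
          · subst hij; simp; rfl
          · simp [hij]; rfl
      | inv_mul n A hA i j =>
        have := RingQuot.mkAlgHom_rel ℚ (FreeSkewFieldRel.inv_mul n (A.map f) (hf n A hA) i j)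
        simp only [map_sum, map_mul, key, FreeAlgebra.lift_ι_apply]
        refine Eq.trans ?_ (this.trans ?_)
        · simp [mk]
          rfl
        · by_cases hij : i = j
          · subst hij; simp; rfl
          · simp [hij]; rfl⟩

theorem map_gen {X : Type u} {Y : Type v} (f : FreeAlgebra ℚ X →ₐ[ℚ] FreeAlgebra ℚ Y)
    (hf : ∀ (n : ℕ) (A : Matrix (Fin n) (Fin n) (FreeAlgebra ℚ X)),
      IsFullMatrix A → IsFullMatrix (A.map f)) (x : X) :
    map f hf (gen x) = ofFree Y (f (FreeAlgebra.ι ℚ x)) := by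
  simp only [gen, ofFree, mk, FreeSkewFieldGen.ofFree]
  refine (RingQuot.liftAlgHom_mkAlgHom_apply ℚ _ _ _).trans ?_
  simp [ofFree, mk, FreeSkewFieldGen.ofFree]

/-- A homomorphism with a left inverse preserves full matrices. -/
theorem full_of_leftInverse {X : Type u} {Y : Type v}
    (f : FreeAlgebra ℚ X →ₐ[ℚ] FreeAlgebra ℚ Y) (r : FreeAlgebra ℚ Y →ₐ[ℚ] FreeAlgebra ℚ X)
    (hr : r.comp f = AlgHom.id ℚ (FreeAlgebra ℚ X))
    (n : ℕ) (A : Matrix (Fin n) (Fin n) (FreeAlgebra ℚ X)) (hA : IsFullMatrix A) :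
    IsFullMatrix (A.map f) := by
  intro m P S h
  refine hA m (P.map r) (S.map r) ?_
  have h2 := congrArg (fun M => M.map r) h
  simp only [Matrix.map_map, Matrix.map_mul] at h2
  rw [← h2]
  ext i j
  exact (DFunLike.congr_fun hr (A i j)).symm

open Classical in
/-- The homomorphism `𝓕(X) → 𝓕(Y)` induced by an injective map `X → Y` of variables. -/
noncomputable def incl {X : Type u} {Y : Type v} (e : X → Y) (he : Function.Injective e) :
    FreeSkewField X →ₐ[ℚ] FreeSkewField Y :=
  map (FreeAlgebra.lift ℚ fun x => FreeAlgebra.ι ℚ (e x))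
    (full_of_leftInverse _
      (FreeAlgebra.lift ℚ fun y => if h : ∃ x, e x = y then FreeAlgebra.ι ℚ h.choose else 0) (by
        ext x
        have h : ∃ x', e x' = e x := ⟨x, rfl⟩
        simp only [Function.comp_apply, AlgHom.comp_apply, FreeAlgebra.lift_ι_apply, dif_pos h,
          AlgHom.id_apply]
        rw [he h.choose_spec]))

theorem incl_gen {X : Type u} {Y : Type v} (e : X → Y) (he : Function.Injective e) (x : X) :
    incl e he (gen x) = gen (e x) := by
  rw [incl, map_gen]
  simp [gen]

end FreeSkewField

/-! ### Double brackets -/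

/-- A `ℚ`-bilinear map `A × A → A ⊗ A` is a double bracket if it is a derivation in the second
argument for the outer bimodule structure, and `⟦b, a⟧ = -⟦a, b⟧^τ` with `τ` the flip. -/
structure IsDoubleBracket {A : Type u} [Ring A] [Algebra ℚ A]
    (br : A →ₗ[ℚ] A →ₗ[ℚ] A ⊗[ℚ] A) : Prop where
  leibniz : ∀ a b c : A, br a (b * c) = br a b * (1 ⊗ₜ[ℚ] c) + (b ⊗ₜ[ℚ] 1) * br a c
  skew : ∀ a b : A, br b a = -(TensorProduct.comm ℚ A A (br a b))

/-! ### Directed fat graphs with white, black and boundary vertices -/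

/-- The kinds of vertices. -/
inductive VertexKind
  | white
  | black
  | boundary

/-- The two half-edges `α_s`, `α_t` (source end and target end) of the arrows `α`. -/
inductive HalfEdge (E : Type u) : Type u
  | s (α : E) : HalfEdge E
  | t (α : E) : HalfEdge E

/-- The vertex at which a half-edge is attached. -/
def HalfEdge.vertex {V E : Type u} (source target : E → V) : HalfEdge E → V
  | .s α => source α
  | .t α => target α

/-- The quiver of a perfect network, with the cyclic orders at its vertices: `rot h` is the
half-edge which follows `h` counter-clockwise around the vertex of `h`. White vertices have one
incoming and two outgoing arrows, black vertices two incoming and one outgoing, and boundary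
vertices are univalent. -/
structure PerfectQuiver (V E : Type u) where
  source : E → V
  target : E → V
  kind : V → VertexKind
  rot : Equiv.Perm (HalfEdge E)
  vertex_rot : ∀ h, (rot h).vertex source target = h.vertex source target
  rot_cyclic : ∀ h h', h.vertex source target = h'.vertex source target → rot.SameCycle h h'
  white_in : ∀ p, kind p = .white → {α | target α = p}.ncard = 1
  white_out : ∀ p, kind p = .white → {α | source α = p}.ncard = 2
  black_in : ∀ p, kind p = .black → {α | target α = p}.ncard = 2
  black_out : ∀ p, kind p = .black → {α | source α = p}.ncard = 1
  boundary_card : ∀ p, kind p = .boundary →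
    {h : HalfEdge E | h.vertex source target = p}.ncard = 1

namespace PerfectQuiver

variable {V E : Type u} (Q : PerfectQuiver V E)

/-- The half-edges at the vertex `p`. -/
abbrev Star (p : V) : Type u := {h : HalfEdge E // h.vertex Q.source Q.target = p}

/-- The next half-edge at `p`, counter-clockwise. -/
def next {p : V} (h : Q.Star p) : Q.Star p := ⟨Q.rot h.1, (Q.vertex_rot h.1).trans h.2⟩

/-- The defining values of the double bracket on the free skew field of the half-edges at `p`.
At a white vertex, `x` is the incoming half-edge and `y`, `z` the outgoing ones, `x, y, z` being
counter-clockwise. At a black vertex, `a` is the outgoing half-edge and `b`, `c` the incoming ones,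
`a, c, b` being counter-clockwise. At a boundary vertex the bracket is trivial. -/
structure IsLocalBracket (w₁ w₂ w₃ k₁ k₂ k₃ : ℚ) (p : V)
    (br : FreeSkewField (Q.Star p) →ₗ[ℚ] FreeSkewField (Q.Star p) →ₗ[ℚ]
      FreeSkewField (Q.Star p) ⊗[ℚ] FreeSkewField (Q.Star p)) : Prop where
  isDoubleBracket : IsDoubleBracket br
  self : ∀ h : Q.Star p, br (.gen h) (.gen h) = 0
  white : Q.kind p = .white → ∀ (α : E) (hα : Q.target α = p),
    let hx : Q.Star p := ⟨.t α, hα⟩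
    let x : FreeSkewField (Q.Star p) := .gen hx
    let y : FreeSkewField (Q.Star p) := .gen (Q.next hx)
    let z : FreeSkewField (Q.Star p) := .gen (Q.next (Q.next hx))
    br x y = w₁ • (1 ⊗ₜ[ℚ] (x * y)) ∧ br x z = w₂ • (1 ⊗ₜ[ℚ] (x * z)) ∧
      br y z = w₃ • (y ⊗ₜ[ℚ] z)
  black : Q.kind p = .black → ∀ (α : E) (hα : Q.source α = p),
    let ha : Q.Star p := ⟨.s α, hα⟩
    let a : FreeSkewField (Q.Star p) := .gen ha
    let c : FreeSkewField (Q.Star p) := .gen (Q.next ha)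
    let b : FreeSkewField (Q.Star p) := .gen (Q.next (Q.next ha))
    br a b = k₁ • ((b * a) ⊗ₜ[ℚ] 1) ∧ br a c = k₂ • ((c * a) ⊗ₜ[ℚ] 1) ∧
      br b c = k₃ • (c ⊗ₜ[ℚ] b)
  boundary : Q.kind p = .boundary → br = 0

/-- The inclusion of the free skew field of a vertex into `H_Q`, the free skew field on all the
half-edges. -/
noncomputable def star (p : V) : FreeSkewField (Q.Star p) →ₐ[ℚ] FreeSkewField (HalfEdge E) :=
  FreeSkewField.incl Subtype.val Subtype.val_injective

/-- A double bracket on `H_Q` which restricts to the local double bracket at each vertex, and is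
zero between the free skew fields of distinct vertices. -/
structure IsHalfEdgeBracket (w₁ w₂ w₃ k₁ k₂ k₃ : ℚ)
    (br : FreeSkewField (HalfEdge E) →ₗ[ℚ] FreeSkewField (HalfEdge E) →ₗ[ℚ]
      FreeSkewField (HalfEdge E) ⊗[ℚ] FreeSkewField (HalfEdge E)) : Prop where
  isDoubleBracket : IsDoubleBracket br
  restrict : ∀ p : V, ∃ loc, Q.IsLocalBracket w₁ w₂ w₃ k₁ k₂ k₃ p loc ∧
    ∀ a b, br (Q.star p a) (Q.star p b) =
      Algebra.TensorProduct.map (Q.star p) (Q.star p) (loc a b)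
  cross : ∀ p q : V, p ≠ q → ∀ a b, br (Q.star p a) (Q.star q b) = 0

end PerfectQuiver

/-- The glueing homomorphism `g* : 𝓕(E) → 𝓕(half-edges)` with `g*(α) = α_s α_t`. -/
noncomputable def glue (E : Type u) : FreeSkewField E →ₐ[ℚ] FreeSkewField (HalfEdge E) :=
  FreeSkewField.map
    (FreeAlgebra.lift ℚ fun α : E =>
      FreeAlgebra.ι ℚ (HalfEdge.s α) * FreeAlgebra.ι ℚ (HalfEdge.t α))
    (FreeSkewField.full_of_leftInverse _
      (FreeAlgebra.lift ℚ fun h : HalfEdge E => match h with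
        | .s α => FreeAlgebra.ι ℚ α
        | .t _ => 1)
      (by ext α; simp))

theorem glue_gen {E : Type u} (α : E) :
    glue E (.gen α) = .gen (HalfEdge.s α) * .gen (HalfEdge.t α) := by
  rw [glue, FreeSkewField.map_gen]
  simp [FreeSkewField.gen]

-- The statements about brackets reduce to values on variables. A double bracket is a derivation in
-- each argument, and a derivation of `𝓕(X)` may be prescribed arbitrarily on the variables and is
-- determined there. Indeed, a derivation is a homomorphism to upper triangular 2 × 2 matrices with
-- prescribed diagonal. It extends from `ℚ⟨X⟩` to `𝓕(X)` because a matrix over the upper triangular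
-- ring is invertible as soon as its two diagonal parts are (`exists_derivationAlong`,
-- `derivationAlong_ext`). Using this in both arguments gives `exists_doubleBracket` and
-- `doubleBracket_ext`, which settle the local brackets and the bracket on all half-edges.
--
-- For the glueing, expand the bracket of `α_s α_t` and `β_s β_t` by the Leibniz rules. At every
-- kind of vertex the local values have the same shape: target ends give multiples of `β_t ⊗ α_t`,
-- source ends multiples of `α_s ⊗ β_s`, mixed ends multiples of `1 ⊗ α_t β_s`. In each of the four
-- terms every source end is then followed by its own target end, so the result lies in the image of
-- `g* ⊗ g*` (`exists_glue_eq`). The preimages are the values of the bracket on the arrows; that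
-- they are skew, and that the bracket is unique, follows from the injectivity of `g* ⊗ g*`, hence
-- of `g*`.
--
-- Injectivity of `g*` is the deep input. It needs that nonzero elements of `𝓕(X)` are units
-- (`eq_zero_or_isUnit`) and that `𝓕(X)` is not the zero ring (`instNontrivial`). As `𝓕(X)` is
-- defined by inverting full matrices, both rest on the arithmetic of the free algebra. The weak
-- algorithm shows that a matrix relation `P * S = 0` becomes trivial, entry by entry in the middle
-- index, after a base change (`exists_trivialization`). Hence block triangular matrices with full
-- diagonal blocks are full. Elements of `𝓕(X)` are then of the form `f * A⁻¹ * m` with `A` full,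
-- and such an element is zero or a unit according to whether the bordered matrix is full. For
-- nontriviality, one adjoins formal solutions of all full linear systems to a free module of rank
-- one and divides by the saturation of the equations; the distinguished generator survives, again
-- by trivialization of relations.

universe w

/-! ### The weak algorithm in the free algebra -/

namespace WordAlgebra

variable {K : Type v} [Field K] {X : Type u}

/-- All words in `p` have length less than `d`. -/
def DegLT (d : ℕ) (p : MonoidAlgebra K (FreeMonoid X)) : Prop :=
  ∀ w : FreeMonoid X, d ≤ w.length → p.coeff w = 0

theorem DegLT.mono {d e : ℕ} (h : d ≤ e) {p : MonoidAlgebra K (FreeMonoid X)} (hp : DegLT d p) :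
    DegLT e p :=
  fun w hw => hp w (h.trans hw)

theorem degLT_zero_iff {p : MonoidAlgebra K (FreeMonoid X)} : DegLT 0 p ↔ p = 0 := by
  constructor
  · intro h
    ext w
    exact h w (Nat.zero_le _)
  · rintro rfl w _
    rfl

theorem DegLT.sub {d : ℕ} {p q : MonoidAlgebra K (FreeMonoid X)} (hp : DegLT d p)
    (hq : DegLT d q) : DegLT d (p - q) := by
  intro w hw
  simp [hp w hw, hq w hw]

theorem DegLT.sum {ι : Type*} {d : ℕ} (s : Finset ι) {p : ι → MonoidAlgebra K (FreeMonoid X)}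
    (hp : ∀ i ∈ s, DegLT d (p i)) : DegLT d (∑ i ∈ s, p i) := by
  intro w hw
  rw [MonoidAlgebra.coeff_sum, Finset.sum_apply']
  exact Finset.sum_eq_zero fun i hi => hp i hi w hw

theorem DegLT.smul {d : ℕ} (r : K) {p : MonoidAlgebra K (FreeMonoid X)} (hp : DegLT d p) :
    DegLT d (r • p) := by
  intro w hw
  simp [hp w hw]

theorem exists_degLT (p : MonoidAlgebra K (FreeMonoid X)) : ∃ d, DegLT d p := by
  refine ⟨p.coeff.support.sup FreeMonoid.length + 1, fun w hw => ?_⟩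
  by_contra h
  have := Finset.le_sup (f := FreeMonoid.length) (Finsupp.mem_support_iff.mpr h)
  omega

/-- The operator which removes the initial letter `x` of words, and kills the words which do not
start with `x`. -/
noncomputable def strip (x : X) :
    MonoidAlgebra K (FreeMonoid X) →ₗ[K] MonoidAlgebra K (FreeMonoid X) where
  toFun p := .ofCoeff (Finsupp.comapDomain (fun w => FreeMonoid.of x * w) p.coeff
    (mul_right_injective _).injOn)
  map_add' p q := by ext; simp [Finsupp.comapDomain]
  map_smul' r p := by ext; simp [Finsupp.comapDomain]

theorem coeff_strip (x : X) (p : MonoidAlgebra K (FreeMonoid X)) (w : FreeMonoid X) :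
    (strip x p).coeff w = p.coeff (FreeMonoid.of x * w) := rfl

theorem DegLT.strip {d : ℕ} (x : X) {p : MonoidAlgebra K (FreeMonoid X)} (hp : DegLT d p) :
    DegLT (d - 1) (strip x p) := by
  intro w hw
  rw [coeff_strip]
  apply hp
  rw [FreeMonoid.length_mul, FreeMonoid.length_of]
  omega

/-- The initial letter of a product of words belongs to the left word, unless that word is empty;
only the constant term of `p` lets `strip x` reach `q`. -/
theorem strip_mul (x : X) (p q : MonoidAlgebra K (FreeMonoid X)) :
    strip x (p * q) = strip x p * q + p.coeff 1 • strip x q := by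
  classical
  induction p using MonoidAlgebra.induction_linear with
  | zero => simp
  | add p₁ p₂ h₁ h₂ =>
    rw [add_mul, map_add, h₁, h₂, map_add, add_mul, MonoidAlgebra.coeff_add, Finsupp.add_apply,
      add_smul]
    abel
  | single m r =>
    induction q using MonoidAlgebra.induction_linear with
    | zero => simp
    | add q₁ q₂ h₁ h₂ =>
      rw [mul_add, map_add, h₁, h₂, map_add, mul_add, smul_add]
      abel
    | single m' r' =>
      rw [MonoidAlgebra.single_mul_single]
      cases m with
      | one =>
        have : strip x (MonoidAlgebra.single (1 : FreeMonoid X) r) = 0 := by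
          ext w
          rw [coeff_strip, MonoidAlgebra.coeff_single, Finsupp.single_apply, if_neg]
          · rfl
          · intro h
            have := congrArg FreeMonoid.length h
            rw [FreeMonoid.length_mul, FreeMonoid.length_of, FreeMonoid.length_one] at this
            omega
        rw [this, zero_mul, zero_add, one_mul, MonoidAlgebra.coeff_single, Finsupp.single_eq_same,
          ← map_smul, MonoidAlgebra.smul_single, smul_eq_mul]
      | of_mul y m =>
        have h0 : (MonoidAlgebra.single (FreeMonoid.of y * m) r).coeff 1 = 0 := by
          rw [MonoidAlgebra.coeff_single, Finsupp.single_apply, if_neg]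
          intro h
          have := congrArg FreeMonoid.length h
          rw [FreeMonoid.length_mul, FreeMonoid.length_of, FreeMonoid.length_one] at this
          omega
        have key : ∀ (m : FreeMonoid X) (r : K),
            strip x (MonoidAlgebra.single (FreeMonoid.of y * m) r) =
              if y = x then MonoidAlgebra.single m r else 0 := by
          intro m r
          ext w
          rw [coeff_strip, MonoidAlgebra.coeff_single, Finsupp.single_apply]
          by_cases hyx : y = x
          · subst hyx
            simp [Finsupp.single_apply]
          · rw [if_neg, if_neg hyx]
            · rfl
            · intro h
              have h2 := congrArg FreeMonoid.toList h
              rw [FreeMonoid.toList_of_mul, FreeMonoid.toList_of_mul] at h2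
              exact hyx (List.cons.inj h2).1
        rw [h0, zero_smul, add_zero, mul_assoc, key, key]
        split_ifs
        · rw [MonoidAlgebra.single_mul_single]
        · rw [zero_mul]

theorem eq_single_of_degLT_one {p : MonoidAlgebra K (FreeMonoid X)} (hp : DegLT 1 p) :
    p = MonoidAlgebra.single 1 (p.coeff 1) := by
  classical
  ext w
  rw [MonoidAlgebra.coeff_single, Finsupp.single_apply]
  split_ifs with h
  · rw [h]
  · apply hp
    by_contra hw
    exact h (FreeMonoid.length_eq_zero.mp (by omega)).symm

/-- The weak algorithm: if the leading terms of the vectors `s i` satisfy a linear relation, then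
some `s i` can be reduced to smaller degree by the other ones. -/
theorem weak_algorithm {ι κ : Type*} [Fintype ι] (good : ι → Prop)
    (s : ι → κ → MonoidAlgebra K (FreeMonoid X)) (o : ι → ℕ)
    (hs : ∀ i j, DegLT (o i + 1) (s i j)) (D : ℕ) (p : ι → MonoidAlgebra K (FreeMonoid X))
    (hgood : ∀ i, ¬ good i → p i = 0)
    (hp : ∀ i, DegLT (D + 1 - o i) (p i)) (hsum : ∀ j, DegLT D (∑ i, p i * s i j))
    (hex : ∃ i, o i ≤ D ∧ ¬ DegLT (D - o i) (p i)) :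
    ∃ i, good i ∧ ∃ c : ι → MonoidAlgebra K (FreeMonoid X), c i = 1 ∧
      ∀ j, DegLT (o i) (∑ i', c i' * s i' j) := by
  induction D generalizing p with
  | zero =>
    obtain ⟨i, hi, hpi⟩ := hex
    have hoi : o i = 0 := by omega
    have h1 := hp i
    rw [hoi] at h1 hpi
    have h2 := eq_single_of_degLT_one h1
    -- The coefficient of `s i` is a nonzero constant, so dividing the whole relation by it gives
    -- the reduction.
    have hne : (p i).coeff 1 ≠ 0 := by
      intro h
      rw [h, MonoidAlgebra.single_zero] at h2
      exact hpi (degLT_zero_iff.mpr h2)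
    refine ⟨i, ?_, fun j => ((p i).coeff 1)⁻¹ • p j, ?_, fun j => ?_⟩
    · by_contra h
      rw [hgood i h] at hne
      exact hne rfl
    · dsimp only
      nth_rw 2 [h2]
      rw [MonoidAlgebra.smul_single, smul_eq_mul, inv_mul_cancel₀ hne, MonoidAlgebra.one_def]
    · simp only [smul_mul_assoc, ← Finset.smul_sum]
      rw [hoi]
      exact (hsum j).smul _
  | succ D ih =>
    -- If a vector of top degree takes part, its coefficient is a constant and one divides by it.
    -- Otherwise all coefficients of top weight are nonconstant, and stripping the first letter of a
    -- leading word lowers `D`.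
    by_cases hcase : ∃ i, o i = D + 1 ∧ p i ≠ 0
    · obtain ⟨i, hoi, hpi⟩ := hcase
      have h1 := hp i
      rw [hoi, show D + 1 + 1 - (D + 1) = 1 by omega] at h1
      have h2 := eq_single_of_degLT_one h1
      have hne : (p i).coeff 1 ≠ 0 := by
        intro h
        rw [h, MonoidAlgebra.single_zero] at h2
        exact hpi h2
      refine ⟨i, ?_, fun j => ((p i).coeff 1)⁻¹ • p j, ?_, fun j => ?_⟩
      · by_contra h
        exact hpi (hgood i h)
      · dsimp only
        nth_rw 2 [h2]
        rw [MonoidAlgebra.smul_single, smul_eq_mul, inv_mul_cancel₀ hne, MonoidAlgebra.one_def]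
      · simp only [smul_mul_assoc, ← Finset.smul_sum]
        rw [hoi]
        exact (hsum j).smul _
    · push Not at hcase
      obtain ⟨i, hi, hpi⟩ := hex
      have hlt : o i ≤ D := by
        by_contra h
        have : o i = D + 1 := by omega
        apply hpi
        rw [this, hcase i this]
        exact degLT_zero_iff.mpr rfl |>.mono (Nat.zero_le _)
      unfold DegLT at hpi
      push Not at hpi
      obtain ⟨w, hw, hpw⟩ := hpi
      cases w with
      | one =>
        rw [FreeMonoid.length_one] at hw
        omega
      | of_mul x w =>
        rw [FreeMonoid.length_mul, FreeMonoid.length_of] at hw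
        refine ih (fun i => strip x (p i)) (fun i hi => by rw [hgood i hi, map_zero])
          (fun i => ((hp i).strip x).mono (by omega)) (fun j => ?_) ⟨i, hlt, fun h => ?_⟩
        · have h1 := (hsum j).strip x
          rw [map_sum] at h1
          simp only [strip_mul] at h1
          rw [Finset.sum_add_distrib] at h1
          -- The correction terms of `strip_mul` are harmless: the vectors that take part have
          -- degree at most `D`, and stripping lowers this by one.
          have h2 : DegLT D (∑ i, (p i).coeff 1 • strip x (s i j)) := by
            refine DegLT.sum _ fun i _ => ?_
            by_cases hoi : o i ≤ D
            · exact (((hs i j).strip x).mono (by omega)).smul _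
            · have : p i = 0 := by
                by_cases h : o i = D + 1
                · exact hcase i h
                · have := hp i
                  rwa [show D + 1 + 1 - o i = 0 by omega, degLT_zero_iff] at this
              rw [this, MonoidAlgebra.coeff_zero, Finsupp.zero_apply, zero_smul]
              exact degLT_zero_iff.mpr rfl |>.mono (Nat.zero_le _)
          have h3 := h1.sub h2
          rwa [add_sub_cancel_right] at h3
        · exact hpw (h w (by omega))

end WordAlgebra

/-! ### Row reduction over the word algebra -/

namespace WordAlgebra

variable {K : Type v} [Field K] {X : Type u}

theorem exists_forall_degLT {κ : Type*} [Fintype κ] (s : κ → MonoidAlgebra K (FreeMonoid X)) :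
    ∃ d, ∀ j, DegLT d (s j) := by
  choose d hd using fun j => exists_degLT (s j)
  exact ⟨Finset.univ.sup d, fun j => (hd j).mono (Finset.le_sup (Finset.mem_univ j))⟩

open Classical in
/-- The least strict bound for the degrees of the entries of a vector. -/
noncomputable def degBound {κ : Type*} [Fintype κ] (s : κ → MonoidAlgebra K (FreeMonoid X)) : ℕ :=
  Nat.find (exists_forall_degLT s)

theorem degLT_degBound {κ : Type*} [Fintype κ] (s : κ → MonoidAlgebra K (FreeMonoid X)) (j : κ) :
    DegLT (degBound s) (s j) := by
  classical
  exact Nat.find_spec (exists_forall_degLT s) j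

theorem degBound_le {κ : Type*} [Fintype κ] {s : κ → MonoidAlgebra K (FreeMonoid X)} {d : ℕ}
    (h : ∀ j, DegLT d (s j)) : degBound s ≤ d := by
  classical
  exact Nat.find_min' (exists_forall_degLT s) h

theorem degBound_pos {κ : Type*} [Fintype κ] {s : κ → MonoidAlgebra K (FreeMonoid X)}
    (h : s ≠ 0) : 0 < degBound s := by
  by_contra h0
  have h1 : degBound s = 0 := by omega
  apply h
  ext1 j
  have := degLT_degBound s j
  rwa [h1, degLT_zero_iff] at this

/-- A left linear relation between the rows of a matrix, involving a nonzero row, allows to reduce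
the degree of some row. -/
theorem exists_row_reduction {ι κ : Type*} [Fintype ι] [Fintype κ]
    (s : ι → κ → MonoidAlgebra K (FreeMonoid X)) (p : ι → MonoidAlgebra K (FreeMonoid X))
    (hp : ∀ j, ∑ i, p i * s i j = 0) (hne : ∃ i, p i ≠ 0 ∧ s i ≠ 0) :
    ∃ i, ∃ c : ι → MonoidAlgebra K (FreeMonoid X), c i = 1 ∧
      degBound (fun j => ∑ i', c i' * s i' j) < degBound (s i) := by
  classical
  obtain ⟨i₀, hpi₀, hsi₀⟩ := hne
  set q : ι → MonoidAlgebra K (FreeMonoid X) := fun i => if s i = 0 then 0 else p i with hq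
  have hq0 : ∀ i, s i = 0 → q i = 0 := fun i h => if_pos h
  set b : ι → ℕ := fun i => degBound (fun _ : Unit => q i) with hb
  set o : ι → ℕ := fun i => degBound (s i) - 1 with ho
  have hbpos : ∀ i, q i ≠ 0 → 0 < b i := fun i hi =>
    degBound_pos fun h => hi (congrFun h ())
  -- The weight `b i - 1 + o i` is the degree of the product of leading terms in `q i * s i`; its
  -- maximum serves as `D`, and the index `m` attaining it has a coefficient of exact degree.
  obtain ⟨m, hm, hmax⟩ := Finset.exists_max_image (Finset.univ.filter fun i => q i ≠ 0)
    (fun i => b i - 1 + o i) ⟨i₀, by simp [hq, hpi₀, hsi₀]⟩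
  rw [Finset.mem_filter] at hm
  -- For a zero row the subtraction in `o` truncates, so nothing could be gained there. Requiring
  -- the reduced row to be nonzero makes its strict bound equal to `o i + 1`, which then really
  -- drops.
  obtain ⟨i, hi, c, hci, hc⟩ := weak_algorithm (fun i => s i ≠ 0) s o
    (fun i j => (degLT_degBound (s i) j).mono (by simp only [ho]; omega)) (b m - 1 + o m) q
    (fun i hi => hq0 i (not_not.mp hi))
    (fun i => by
      by_cases h : q i = 0
      · rw [h]
        exact (degLT_zero_iff.mpr rfl).mono (Nat.zero_le _)
      · have h1 := hmax i (Finset.mem_filter.mpr ⟨Finset.mem_univ _, h⟩)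
        have h2 := hbpos i h
        exact (degLT_degBound (fun _ : Unit => q i) ()).mono (by
          change b i ≤ _
          omega))
    (fun j => by
      have : ∑ i, q i * s i j = ∑ i, p i * s i j := by
        refine Finset.sum_congr rfl fun i _ => ?_
        by_cases h : s i = 0
        · simp [h]
        · simp [hq, h]
      rw [this, hp]
      exact (degLT_zero_iff.mpr rfl).mono (Nat.zero_le _))
    ⟨m, by omega, fun h => by
      rw [Nat.add_sub_cancel] at h
      have h1 : b m ≤ b m - 1 := degBound_le fun _ => h
      have h2 := hbpos m hm.2
      omega⟩
  refine ⟨i, c, hci, ?_⟩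
  have h1 := degBound_le hc
  have h2 := degBound_pos hi
  simp only [ho] at h1
  omega

/-- Every matrix over the word algebra can be transformed by an invertible matrix such that its
nonzero rows become left linearly independent. -/
theorem exists_reduced_rows {ι κ : Type*} [Fintype ι] [DecidableEq ι] [Fintype κ]
    (s : Matrix ι κ (MonoidAlgebra K (FreeMonoid X))) :
    ∃ T T' : Matrix ι ι (MonoidAlgebra K (FreeMonoid X)), T' * T = 1 ∧
      ∀ p : ι → MonoidAlgebra K (FreeMonoid X), Matrix.vecMul p (T * s) = 0 →
        ∀ i, p i = 0 ∨ (T * s) i = 0 := by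
  induction hN : ∑ i, degBound (s i) using Nat.strong_induction_on generalizing s with
  | _ N ih =>
    by_cases hind : ∀ p : ι → MonoidAlgebra K (FreeMonoid X), Matrix.vecMul p s = 0 →
        ∀ i, p i = 0 ∨ s i = 0
    · exact ⟨1, 1, Matrix.one_mul 1, by rwa [Matrix.one_mul]⟩
    · push Not at hind
      obtain ⟨p, hp, hne⟩ := hind
      obtain ⟨i, c, hci, hc⟩ := exists_row_reduction s p (fun j => congrFun hp j) hne
      -- Since `c i = 1`, one has `U = 1 + N` with `N` concentrated in row `i`, equal there to `c -
      -- e_i`, and `N * N = 0`. The inverse is `1 - N`, whose row `i` is `2 e_i - c`.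
      set U : Matrix ι ι (MonoidAlgebra K (FreeMonoid X)) := Matrix.updateRow 1 i c with hU
      set U' : Matrix ι ι (MonoidAlgebra K (FreeMonoid X)) :=
        Matrix.updateRow 1 i (Pi.single i 2 - c) with hU'
      have hUU : U' * U = 1 := by
        ext a b
        rw [Matrix.mul_apply]
        by_cases ha : a = i
        · subst ha
          have h1 : ∀ l, U' a l * U l b = (if l = a then c b else 0) +
              (if l = b then (if b = a then 0 else - c b) else 0) := by
            intro l
            by_cases hl : l = a
            · subst hl
              by_cases hlb : l = b
              · subst hlb
                simp [hU, hU', hci]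
                norm_num
              · have : (2 : MonoidAlgebra K (FreeMonoid X)) - 1 = 1 := by norm_num
                simp [hU, hU', hci, hlb, this]
            · by_cases hlb : l = b
              · subst hlb
                simp [hU, hU', hl]
              · simp [hU, hU', hl, hlb, Matrix.one_apply_ne hlb]
          simp only [h1, Finset.sum_add_distrib, Finset.sum_ite_eq', Finset.mem_univ, if_true]
          by_cases hab : b = a
          · subst hab
            simp [hci]
          · simp [hab, Matrix.one_apply_ne (Ne.symm hab)]
        · have h1 : ∀ l, U' a l * U l b = if l = a then (1 : Matrix ι ι _) a b else 0 := by
            intro l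
            by_cases hl : l = a
            · subst hl
              simp [hU, hU', ha]
            · simp [hU', ha, hl, Matrix.one_apply_ne (Ne.symm hl)]
          simp [h1]
      have hUs : ∀ a, a ≠ i → (U * s) a = s a := by
        intro a ha
        ext1 j
        simp [Matrix.mul_apply, hU, ha, Matrix.one_apply]
      have hUi : (U * s) i = fun j => ∑ i', c i' * s i' j := by
        ext1 j
        simp [Matrix.mul_apply, hU]
      have hlt : ∑ a, degBound ((U * s) a) < N := by
        rw [← hN]
        refine Finset.sum_lt_sum (fun a _ => ?_) ⟨i, Finset.mem_univ _, ?_⟩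
        · by_cases ha : a = i
          · subst ha
            rw [hUi]
            exact hc.le
          · rw [hUs a ha]
        · rw [hUi]
          exact hc
      obtain ⟨T, T', hT, hred⟩ := ih _ hlt (U * s) rfl
      refine ⟨T * U, U' * T', ?_, ?_⟩
      · calc U' * T' * (T * U) = U' * (T' * T) * U := by simp only [Matrix.mul_assoc]
          _ = 1 := by rw [hT, Matrix.mul_one, hUU]
      · rwa [Matrix.mul_assoc]

end WordAlgebra

/-! ### Relations between matrices over the free algebra -/

/-- Every product of matrices over the word algebra which is zero can be made trivially zero by an
intermediate base change. -/
theorem WordAlgebra.exists_trivialization {K : Type v} [Field K] {X : Type u} {ι κ l : Type*}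
    [Fintype ι] [DecidableEq ι] [Fintype l]
    (P : Matrix κ ι (MonoidAlgebra K (FreeMonoid X)))
    (S : Matrix ι l (MonoidAlgebra K (FreeMonoid X))) (h : P * S = 0) :
    ∃ T T' : Matrix ι ι (MonoidAlgebra K (FreeMonoid X)), T' * T = 1 ∧
      ∀ i, (∀ k, (P * T') k i = 0) ∨ (∀ j, (T * S) i j = 0) := by
  obtain ⟨T, T', hT, hred⟩ := WordAlgebra.exists_reduced_rows S
  refine ⟨T, T', hT, fun i => ?_⟩
  -- Each row of `P * T'` is a left relation between the rows of `T * S`, so its coefficients vanish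
  -- at the nonzero rows.
  have h1 : (P * T') * (T * S) = 0 := by
    rw [Matrix.mul_assoc, ← Matrix.mul_assoc T', hT, Matrix.one_mul, h]
  by_cases hi : (T * S) i = 0
  · exact Or.inr fun j => congrFun hi j
  · refine Or.inl fun k => ((hred ((P * T') k) ?_) i).resolve_right hi
    ext1 j
    exact congrFun (congrFun h1 k) j

/-- Every product of matrices over the free algebra which is zero can be made trivially zero by an
intermediate base change. -/
theorem FreeAlgebra.exists_trivialization {K : Type v} [Field K] {X : Type u} {ι κ l : Type*}
    [Fintype ι] [DecidableEq ι] [Fintype l]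
    (P : Matrix κ ι (FreeAlgebra K X)) (S : Matrix ι l (FreeAlgebra K X)) (h : P * S = 0) :
    ∃ T T' : Matrix ι ι (FreeAlgebra K X), T' * T = 1 ∧
      ∀ i, (∀ k, (P * T') k i = 0) ∨ (∀ j, (T * S) i j = 0) := by
  set e := (FreeAlgebra.equivMonoidAlgebraFreeMonoid (R := K) (X := X)).toRingEquiv
  obtain ⟨T, T', hT, hred⟩ := WordAlgebra.exists_trivialization (P.map e) (S.map e) (by
    rw [← Matrix.map_mul, h, Matrix.map_zero _ (map_zero e)])
  refine ⟨T.map e.symm, T'.map e.symm, ?_, fun i => ?_⟩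
  · rw [← Matrix.map_mul, hT, Matrix.map_one _ (map_zero _) (map_one _)]
  · have hP : P = (P.map e).map e.symm := by ext; simp
    have hS : S = (S.map e).map e.symm := by ext; simp
    refine (hred i).imp (fun h k => ?_) (fun h j => ?_)
    · rw [hP, ← Matrix.map_mul, Matrix.map_apply, h k, map_zero]
    · rw [hS, ← Matrix.map_mul, Matrix.map_apply, h j, map_zero]

/-! ### Inner rank -/

/-- The matrix `A` does not factor through fewer than `r` dimensions. -/
def InnerRankGE {R : Type u} [Ring R] {ι κ : Type*} (A : Matrix ι κ R) (r : ℕ) : Prop :=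
  ∀ (m : ℕ) (P : Matrix ι (Fin m) R) (S : Matrix (Fin m) κ R), A = P * S → r ≤ m

theorem isFullMatrix_iff {R : Type u} [Ring R] {n : ℕ} {A : Matrix (Fin n) (Fin n) R} :
    IsFullMatrix A ↔ InnerRankGE A n := Iff.rfl

namespace InnerRankGE

variable {R : Type u} [Ring R] {ι κ : Type*} {A : Matrix ι κ R} {r : ℕ}

theorem le_card (hA : InnerRankGE A r) {μ : Type*} [Fintype μ] (P : Matrix ι μ R)
    (S : Matrix μ κ R) (h : A = P * S) : r ≤ Fintype.card μ := by
  refine hA _ (P.submatrix id (Fintype.equivFin μ).symm) (S.submatrix (Fintype.equivFin μ).symm id)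
    ?_
  rw [Matrix.submatrix_mul_equiv, Matrix.submatrix_id_id, h]

theorem le_card_finset (hA : InnerRankGE A r) {μ : Type*} [Fintype μ] (P : Matrix ι μ R)
    (S : Matrix μ κ R) (h : A = P * S) (s : Finset μ)
    (hs : ∀ i, i ∉ s → (∀ k, P k i = 0) ∨ (∀ j, S i j = 0)) : r ≤ s.card := by
  classical
  rw [← Fintype.card_coe]
  refine hA.le_card (P.submatrix id (Subtype.val : s → μ)) (S.submatrix (Subtype.val : s → μ) id) ?_
  rw [h]
  ext k j
  rw [Matrix.mul_apply, Matrix.mul_apply]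
  simp only [Matrix.submatrix_apply, id_eq]
  rw [Finset.sum_coe_sort s (fun i => P k i * S i j)]
  refine (Finset.sum_subset (Finset.subset_univ s) fun i _ hi => ?_).symm
  rcases hs i hi with h | h <;> simp [h]

theorem left_of_mul {μ : Type*} [Fintype μ] {B : Matrix ι μ R} {C : Matrix μ κ R}
    (h : InnerRankGE (B * C) r) : InnerRankGE B r := by
  intro m P S hB
  exact h m P (S * C) (by rw [hB, Matrix.mul_assoc])

theorem right_of_mul {μ : Type*} [Fintype μ] {B : Matrix ι μ R} {C : Matrix μ κ R}
    (h : InnerRankGE (B * C) r) : InnerRankGE C r := by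
  intro m P S hC
  exact h m (B * P) S (by rw [hC, Matrix.mul_assoc])

theorem submatrix_equiv (h : InnerRankGE A r) {ι' κ' : Type*} (e : ι' ≃ ι) (f : κ' ≃ κ) :
    InnerRankGE (A.submatrix e f) r := by
  intro m P S hA
  refine h m (P.submatrix e.symm id) (S.submatrix id f.symm) ?_
  ext i j
  have := congrFun (congrFun hA (e.symm i)) (f.symm j)
  simpa [Matrix.mul_apply] using this

end InnerRankGE

/-! ### Inner rank over the free algebra -/

namespace FreeAlgebra

variable {K : Type v} [Field K] {X : Type u}

/-- In a factorization `P * S` the zero block says that the lower part of `P` annihilates the left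
part of `S`. After trivialization the middle indices split in two: `A` factors through those outside
`s`, and `B` through `s`, so the two ranks add up. This fails over general rings. -/
theorem innerRankGE_fromBlocks {ι κ ι' κ' : Type*} [Fintype ι']
    {A : Matrix ι ι' (FreeAlgebra K X)} {B : Matrix κ κ' (FreeAlgebra K X)} {r r' : ℕ}
    (hA : InnerRankGE A r) (hB : InnerRankGE B r') (C : Matrix ι κ' (FreeAlgebra K X)) :
    InnerRankGE (Matrix.fromBlocks A C 0 B) (r + r') := by
  classical
  intro m P S h
  have h11 : A = P.submatrix Sum.inl id * S.submatrix id Sum.inl := by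
    ext i j
    exact congrFun (congrFun h (Sum.inl i)) (Sum.inl j)
  have h21 : P.submatrix Sum.inr id * S.submatrix id Sum.inl = 0 := by
    ext i j
    exact (congrFun (congrFun h (Sum.inr i)) (Sum.inl j)).symm
  have h22 : B = P.submatrix Sum.inr id * S.submatrix id Sum.inr := by
    ext i j
    exact congrFun (congrFun h (Sum.inr i)) (Sum.inr j)
  obtain ⟨T, T', hT, hz⟩ := exists_trivialization _ _ h21
  set s : Finset (Fin m) := Finset.univ.filter fun i =>
    ∀ j, (T * S.submatrix id Sum.inl : Matrix (Fin m) ι' (FreeAlgebra K X)) i j = 0 with hs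
  have h1 : r ≤ sᶜ.card := by
    refine hA.le_card_finset (P.submatrix Sum.inl id * T') (T * S.submatrix id Sum.inl) ?_ _
      fun i hi => Or.inr ?_
    · rw [Matrix.mul_assoc, ← Matrix.mul_assoc T', hT, Matrix.one_mul, h11]
    · simpa [hs] using hi
  have h2 : r' ≤ s.card := by
    refine hB.le_card_finset (P.submatrix Sum.inr id * T') (T * S.submatrix id Sum.inr) ?_ _
      fun i hi => Or.inl ?_
    · rw [Matrix.mul_assoc, ← Matrix.mul_assoc T', hT, Matrix.one_mul, h22]
    · refine (hz i).resolve_right fun h => hi ?_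
      simpa [hs] using h
  have h3 := s.card_add_card_compl
  rw [Fintype.card_fin] at h3
  omega

/-- After trivializing `v * A = 0`, no row of `T * A` can vanish, since `A = T' * (T * A)` would
then factor through one dimension less. So `v * T'` vanishes. -/
theorem eq_zero_of_vecMul_eq_zero {ι κ : Type*} [Fintype ι] [Fintype κ] {A : Matrix ι κ (FreeAlgebra K X)}
    (hA : InnerRankGE A (Fintype.card ι)) {v : ι → FreeAlgebra K X}
    (hv : Matrix.vecMul v A = 0) : v = 0 := by
  classical
  obtain ⟨T, T', hT, hz⟩ := exists_trivialization (Matrix.replicateRow Unit v) A (by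
    rw [← Matrix.replicateRow_vecMul, hv, Matrix.replicateRow_zero])
  have hz' : ∀ i, Matrix.vecMul v T' i = 0 := by
    intro i
    refine (hz i).elim (fun h => ?_) fun h => ?_
    · have := h ()
      rwa [← Matrix.replicateRow_vecMul] at this
    · exfalso
      have := hA.le_card_finset T' (T * A) (by rw [← Matrix.mul_assoc, hT, Matrix.one_mul])
        (Finset.univ.erase i) fun i' hi' => Or.inr fun j => by
          have : i' = i := by simpa using hi'
          rw [this, h]
      rw [Finset.card_erase_of_mem (Finset.mem_univ i), Finset.card_univ] at this
      have h0 : 0 < Fintype.card ι := Fintype.card_pos_iff.mpr ⟨i⟩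
      omega
  calc v = Matrix.vecMul (Matrix.vecMul v T') T := by
        rw [Matrix.vecMul_vecMul, hT, Matrix.vecMul_one]
    _ = 0 := by rw [funext hz', ← Pi.zero_def, Matrix.zero_vecMul]

theorem eq_zero_of_mulVec_eq_zero {ι κ : Type*} [Fintype κ] {A : Matrix ι κ (FreeAlgebra K X)}
    (hA : InnerRankGE A (Fintype.card κ)) {v : κ → FreeAlgebra K X}
    (hv : Matrix.mulVec A v = 0) : v = 0 := by
  classical
  obtain ⟨T, T', hT, hz⟩ := exists_trivialization A (Matrix.replicateCol Unit v) (by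
    rw [← Matrix.replicateCol_mulVec, hv, Matrix.replicateCol_zero])
  have hz' : ∀ i, Matrix.mulVec T v i = 0 := by
    intro i
    refine (hz i).elim (fun h => ?_) fun h => ?_
    · exfalso
      have := hA.le_card_finset (A * T') T (by rw [Matrix.mul_assoc, hT, Matrix.mul_one])
        (Finset.univ.erase i) fun i' hi' => Or.inl fun j => by
          have : i' = i := by simpa using hi'
          rw [this, h]
      rw [Finset.card_erase_of_mem (Finset.mem_univ i), Finset.card_univ] at this
      have h0 : 0 < Fintype.card κ := Fintype.card_pos_iff.mpr ⟨i⟩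
      omega
    · have := h ()
      rwa [← Matrix.replicateCol_mulVec] at this
  calc v = Matrix.mulVec T' (Matrix.mulVec T v) := by
        rw [Matrix.mulVec_mulVec, hT, Matrix.one_mulVec]
    _ = 0 := by rw [funext hz', ← Pi.zero_def, Matrix.mulVec_zero]

/-- Setting the variables to zero reduces this to the rank of the identity over `K`. -/
theorem innerRankGE_one {ι : Type*} [Fintype ι] [DecidableEq ι] :
    InnerRankGE (1 : Matrix ι ι (FreeAlgebra K X)) (Fintype.card ι) := by
  intro m P S h
  have h1 := congrArg (fun M => M.map (FreeAlgebra.algebraMapInv (R := K) (X := X))) h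
  simp only [Matrix.map_mul, Matrix.map_one _ (map_zero _) (map_one _)] at h1
  calc Fintype.card ι = (1 : Matrix ι ι K).rank := Matrix.rank_one.symm
    _ ≤ m := by
      rw [h1]
      exact (Matrix.rank_mul_le_left _ _).trans ((Matrix.rank_le_card_width _).trans_eq (by simp))

/-- A block diagonal matrix with full blocks is full. -/
theorem innerRankGE_blockDiagonal' {o : Type*} [Fintype o] [DecidableEq o] {m : o → Type*}
    [∀ k, Fintype (m k)] (A : ∀ k, Matrix (m k) (m k) (FreeAlgebra K X))
    (hA : ∀ k, InnerRankGE (A k) (Fintype.card (m k))) :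
    InnerRankGE (Matrix.blockDiagonal' A) (Fintype.card (Σ k, m k)) := by
  classical
  have key : ∀ s : Finset o, InnerRankGE ((Matrix.blockDiagonal' A).submatrix
      (Subtype.val : {x : Σ k, m k // x.1 ∈ s} → _)
      (Subtype.val : {x : Σ k, m k // x.1 ∈ s} → _))
      (Fintype.card {x : Σ k, m k // x.1 ∈ s}) := by
    intro s
    induction s using Finset.induction_on with
    | empty =>
      intro n _ _ _
      have : IsEmpty {x : Σ k, m k // x.1 ∈ (∅ : Finset o)} := ⟨fun x => by simpa using x.2⟩
      rw [Fintype.card_of_isEmpty]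
      exact Nat.zero_le n
    | insert a s ha ih =>
      let e : {x : Σ k, m k // x.1 ∈ insert a s} ≃ m a ⊕ {x : Σ k, m k // x.1 ∈ s} :=
        (Equiv.subtypeEquivRight fun x => Finset.mem_insert).trans
          ((subtypeOrEquiv (fun x : Σ k, m k => x.1 = a) (fun x => x.1 ∈ s) (by
            rw [Pi.disjoint_iff]
            intro x
            rw [Prop.disjoint_iff]
            by_contra h
            exact ha (h.1 ▸ h.2))).trans
          (Equiv.sumCongr (Equiv.sigmaSubtype a) (Equiv.refl _)))
      have h1 := (innerRankGE_fromBlocks (hA a) ih 0).submatrix_equiv e e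
      rw [← Fintype.card_sum, ← Fintype.card_congr e] at h1
      convert h1 using 1
      ext x y
      obtain ⟨x, rfl⟩ := e.symm.surjective x
      obtain ⟨y, rfl⟩ := e.symm.surjective y
      rw [Matrix.submatrix_apply, Matrix.submatrix_apply, e.apply_symm_apply, e.apply_symm_apply]
      rcases x with x | x <;> rcases y with y | y
      · exact Matrix.blockDiagonal'_apply_eq A a x y
      · exact Matrix.blockDiagonal'_apply_ne A _ _ fun h => ha (h ▸ y.2)
      · exact Matrix.blockDiagonal'_apply_ne A _ _ fun h => ha (h ▸ x.2)
      · rfl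
  let e : (Σ k, m k) ≃ {x : Σ k, m k // x.1 ∈ (Finset.univ : Finset o)} :=
    
    (Equiv.subtypeUnivEquiv (p := fun x : Σ k, m k => x.1 ∈ Finset.univ)
      fun x => Finset.mem_univ x.1).symm
  have h := (key Finset.univ).submatrix_equiv e e
  rwa [← Fintype.card_congr e] at h

end FreeAlgebra

/-! ### The universal property of the free skew field -/

namespace FreeSkewField

variable {X : Type u}

theorem inv_mul_map_ofFree {n : ℕ} {A : Matrix (Fin n) (Fin n) (FreeAlgebra ℚ X)}
    (hA : IsFullMatrix A) :
    (Matrix.of fun i j => mk X (FreeAlgebra.ι ℚ (.inv n A hA i j))) * A.map (ofFree X) = 1 := by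
  ext i j
  have h := RingQuot.mkAlgHom_rel ℚ (FreeSkewFieldRel.inv_mul n A hA i j)
  rw [map_sum] at h
  rw [Matrix.mul_apply]
  refine (Finset.sum_congr rfl fun l _ => ?_).trans (h.trans ?_)
  · exact (map_mul (mk X) _ _).symm
  · by_cases hij : i = j
    · subst hij
      rw [Matrix.one_apply_eq, Matrix.one_apply_eq]
      exact map_one (mk X)
    · rw [Matrix.one_apply_ne hij, Matrix.one_apply_ne hij]
      exact map_zero (mk X)

theorem mul_inv_map_ofFree {n : ℕ} {A : Matrix (Fin n) (Fin n) (FreeAlgebra ℚ X)}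
    (hA : IsFullMatrix A) :
    A.map (ofFree X) * (Matrix.of fun i j => mk X (FreeAlgebra.ι ℚ (.inv n A hA i j))) = 1 := by
  ext i j
  have h := RingQuot.mkAlgHom_rel ℚ (FreeSkewFieldRel.mul_inv n A hA i j)
  rw [map_sum] at h
  rw [Matrix.mul_apply]
  refine (Finset.sum_congr rfl fun l _ => ?_).trans (h.trans ?_)
  · exact (map_mul (mk X) _ _).symm
  · by_cases hij : i = j
    · subst hij
      rw [Matrix.one_apply_eq, Matrix.one_apply_eq]
      exact map_one (mk X)
    · rw [Matrix.one_apply_ne hij, Matrix.one_apply_ne hij]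
      exact map_zero (mk X)

theorem isUnit_map_ofFree {n : ℕ} {A : Matrix (Fin n) (Fin n) (FreeAlgebra ℚ X)}
    (hA : IsFullMatrix A) : IsUnit (A.map (ofFree X)) :=
  isUnit_iff_exists.mpr ⟨_, mul_inv_map_ofFree hA, inv_mul_map_ofFree hA⟩

/-- A homomorphism from the free algebra which makes full matrices invertible extends to the free
skew field. -/
theorem exists_extension {S : Type v} [Ring S] [Algebra ℚ S] (f : FreeAlgebra ℚ X →ₐ[ℚ] S)
    (hf : ∀ (n : ℕ) (A : Matrix (Fin n) (Fin n) (FreeAlgebra ℚ X)),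
      IsFullMatrix A → IsUnit (A.map f)) :
    ∃ g : FreeSkewField X →ₐ[ℚ] S, ∀ a, g (ofFree X a) = f a := by
  choose B hB1 hB2 using fun n A hA => isUnit_iff_exists.mp (hf n A hA)
  let φ : FreeAlgebra ℚ (FreeSkewFieldGen X) →ₐ[ℚ] S :=
    FreeAlgebra.lift ℚ fun y : FreeSkewFieldGen X => match y with
      | .var x => f (FreeAlgebra.ι ℚ x)
      | .inv n A hA i j => B n A hA i j
  have hφ : ∀ a, φ (FreeSkewFieldGen.ofFree X a) = f a := by
    intro a
    refine DFunLike.congr_fun (f := φ.comp (FreeSkewFieldGen.ofFree X)) (g := f) ?_ a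
    ext x
    simp [φ, FreeSkewFieldGen.ofFree]
  have hinv : ∀ n A hA i j, φ (FreeAlgebra.ι ℚ (.inv n A hA i j)) = B n A hA i j := by
    intro n A hA i j
    simp [φ]
  refine ⟨RingQuot.liftAlgHom ℚ ⟨φ, ?_⟩, fun a => ?_⟩
  · intro a b h
    cases h with
    | mul_inv n A hA i j =>
      have h := congrFun (congrFun (hB1 n A hA) i) j
      rw [Matrix.mul_apply] at h
      simp only [map_sum, map_mul, hφ, hinv]
      refine h.trans ?_
      by_cases hij : i = j
      · subst hij
        rw [Matrix.one_apply_eq, Matrix.one_apply_eq, map_one]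
      · rw [Matrix.one_apply_ne hij, Matrix.one_apply_ne hij, map_zero]
    | inv_mul n A hA i j =>
      have h := congrFun (congrFun (hB2 n A hA) i) j
      rw [Matrix.mul_apply] at h
      simp only [map_sum, map_mul, hφ, hinv]
      refine h.trans ?_
      by_cases hij : i = j
      · subst hij
        rw [Matrix.one_apply_eq, Matrix.one_apply_eq, map_one]
      · rw [Matrix.one_apply_ne hij, Matrix.one_apply_ne hij, map_zero]
  · exact (RingQuot.liftAlgHom_mkAlgHom_apply ℚ _ _ _).trans (hφ a)

/-- Inverse matrices are unique, so the adjoined entries have no freedom. -/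
theorem algHom_ext {S : Type v} [Ring S] [Algebra ℚ S] {f g : FreeSkewField X →ₐ[ℚ] S}
    (h : ∀ x, f (gen x) = g (gen x)) : f = g := by
  have h0 : f.comp (ofFree X) = g.comp (ofFree X) := FreeAlgebra.hom_ext (funext h)
  have h1 : f.comp (mk X) = g.comp (mk X) := by
    refine FreeAlgebra.hom_ext (funext fun y => ?_)
    cases y with
    | var x =>
      have := h x
      simpa [gen, ofFree, FreeSkewFieldGen.ofFree] using this
    | inv n A hA i j =>
      set B : Matrix (Fin n) (Fin n) (FreeSkewField X) :=
        Matrix.of fun i j => mk X (FreeAlgebra.ι ℚ (.inv n A hA i j)) with hB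
      have hBA := inv_mul_map_ofFree hA
      rw [← hB] at hBA
      have hAB := mul_inv_map_ofFree hA
      rw [← hB] at hAB
      have hfg : (A.map (ofFree X)).map f = (A.map (ofFree X)).map g := by
        ext a b
        exact DFunLike.congr_fun h0 (A a b)
      have hf : B.map f * (A.map (ofFree X)).map f = 1 := by
        rw [← Matrix.map_mul, hBA, Matrix.map_one _ (map_zero f) (map_one f)]
      have hg : (A.map (ofFree X)).map g * B.map g = 1 := by
        rw [← Matrix.map_mul, hAB, Matrix.map_one _ (map_zero g) (map_one g)]
      have : B.map f = B.map g := by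
        rw [← Matrix.mul_one (B.map f), ← hg, ← Matrix.mul_assoc, ← hfg, hf, Matrix.one_mul]
      exact congrFun (congrFun this i) j
  refine RingQuot.ringQuot_ext' ℚ _ _ h1

theorem isUnit_map_of_innerRankGE {ι : Type*} [Fintype ι] [DecidableEq ι]
    {A : Matrix ι ι (FreeAlgebra ℚ X)} (hA : InnerRankGE A (Fintype.card ι)) :
    IsUnit (A.map (ofFree X)) := by
  let e := Fintype.equivFin ι
  have h := isUnit_map_ofFree (isFullMatrix_iff.mpr (hA.submatrix_equiv e.symm e.symm))
  have h2 := h.map (Matrix.reindexRingEquiv (FreeSkewField X) e.symm)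
  convert h2 using 1
  ext i j
  simp

end FreeSkewField

/-! ### Nonzero elements of the free skew field are units -/

namespace FreeSkewField

variable {X : Type u}

/-- The element `p` is of the form `f * A⁻¹ * m`, with `A` full and `f`, `A`, `m` over the free
algebra. -/
def IsRational (p : FreeSkewField X) : Prop :=
  ∃ (ι : Type) (_ : Fintype ι) (A : Matrix ι ι (FreeAlgebra ℚ X)) (f m : ι → FreeAlgebra ℚ X)
    (v : ι → FreeSkewField X), InnerRankGE A (Fintype.card ι) ∧
    (∀ i, ∑ j, ofFree X (A i j) * v j = ofFree X (m i)) ∧ p = ∑ i, ofFree X (f i) * v i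

theorem isRational_ofFree (a : FreeAlgebra ℚ X) : IsRational (ofFree X a) := by
  refine ⟨Unit, inferInstance, 1, fun _ => 1, fun _ => a, fun _ => ofFree X a, ?_, ?_, ?_⟩
  · exact FreeAlgebra.innerRankGE_one
  · simp
  · simp

theorem IsRational.add {p q : FreeSkewField X} (hp : IsRational p) (hq : IsRational q) :
    IsRational (p + q) := by
  obtain ⟨ι, _, A, f, m, v, hA, hv, rfl⟩ := hp
  obtain ⟨κ, _, B, g, l, w, hB, hw, rfl⟩ := hq
  refine ⟨ι ⊕ κ, inferInstance, Matrix.fromBlocks A 0 0 B, Sum.elim f g, Sum.elim m l,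
    Sum.elim v w, ?_, ?_, ?_⟩
  · rw [Fintype.card_sum]
    exact FreeAlgebra.innerRankGE_fromBlocks hA hB 0
  · rintro (i | i)
    · simp [hv]
    · simp [hw]
  · simp

/-- With `A v = m`, `B w = l` and `q = g w`, the vector `(v q, w)` solves the block triangular
system with corner `-m g` and right side `(0, l)`, and `f` reads off `p q`. -/
theorem IsRational.mul {p q : FreeSkewField X} (hp : IsRational p) (hq : IsRational q) :
    IsRational (p * q) := by
  obtain ⟨ι, _, A, f, m, v, hA, hv, rfl⟩ := hp
  obtain ⟨κ, _, B, g, l, w, hB, hw, rfl⟩ := hq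
  refine ⟨ι ⊕ κ, inferInstance, Matrix.fromBlocks A (Matrix.of fun i j => -(m i * g j)) 0 B,
    Sum.elim f 0, Sum.elim 0 l,
    Sum.elim (fun i => v i * ∑ j, ofFree X (g j) * w j) w, ?_, ?_, ?_⟩
  · rw [Fintype.card_sum]
    exact FreeAlgebra.innerRankGE_fromBlocks hA hB _
  · rintro (i | i)
    · simp only [Fintype.sum_sum_type, Matrix.fromBlocks_apply₁₁, Matrix.fromBlocks_apply₁₂,
        Sum.elim_inl, Sum.elim_inr, Matrix.of_apply, map_neg, map_mul, neg_mul, ← mul_assoc]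
      rw [← Finset.sum_mul, hv]
      simp only [Finset.sum_neg_distrib, mul_assoc, ← Finset.mul_sum]
      simp
    · simp [hw]
  · simp only [Fintype.sum_sum_type, Sum.elim_inl, Sum.elim_inr, Pi.zero_apply, map_zero, zero_mul,
      Finset.sum_const_zero, add_zero, Finset.sum_mul, mul_assoc]

theorem isRational (p : FreeSkewField X) : IsRational p := by
  obtain ⟨a, rfl⟩ := RingQuot.mkAlgHom_surjective ℚ (FreeSkewFieldRel X) p
  change IsRational (mk X a)
  induction a using FreeAlgebra.induction with
  | grade0 r =>
    rw [AlgHom.commutes, ← AlgHom.commutes (ofFree X)]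
    exact isRational_ofFree _
  | grade1 y =>
    cases y with
    | var x =>
      have : mk X (FreeAlgebra.ι ℚ (.var x)) = ofFree X (FreeAlgebra.ι ℚ x) := by
        simp [ofFree, FreeSkewFieldGen.ofFree]
      rw [this]
      exact isRational_ofFree _
    | inv n A hA i j =>
      -- An entry of the inverse is `e_i * A⁻¹ * e_j`, so the solution vector is column `j` of the
      -- inverse.
      refine ⟨Fin n, inferInstance, A, Pi.single i 1, Pi.single j 1,
        fun l => mk X (FreeAlgebra.ι ℚ (.inv n A hA l j)), ?_, ?_, ?_⟩
      · rw [Fintype.card_fin]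
        exact isFullMatrix_iff.mp hA
      · intro l
        have h := congrFun (congrFun (mul_inv_map_ofFree hA) l) j
        rw [Matrix.mul_apply] at h
        refine h.trans ?_
        by_cases hlj : l = j
        · subst hlj
          simp
        · simp [Matrix.one_apply_ne hlj, Pi.single_eq_of_ne hlj]
      · rw [Finset.sum_eq_single i]
        · simp
        · intro l _ hl
          simp [Pi.single_eq_of_ne hl]
        · simp
  | mul a b ha hb =>
    rw [map_mul]
    exact ha.mul hb
  | add a b ha hb =>
    rw [map_add]
    exact ha.add hb

/-- Write `p = f A⁻¹ m` and border `A` by the column `m`, the row `f` and the corner `0`. The Schur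
complement of `A` in this matrix `M` is `-p`. If `M` is full, the corner of its inverse is an
inverse of `-p`; if not, a short factorization of `M` forces `p = 0`. -/
theorem eq_zero_or_isUnit (p : FreeSkewField X) : p = 0 ∨ IsUnit p := by
  classical
  obtain ⟨ι, _, A, f, m, v, hA, hv, hp⟩ := isRational p
  obtain ⟨A', -, hA'⟩ := isUnit_iff_exists.mp (isUnit_map_of_innerRankGE hA)
  set M : Matrix (ι ⊕ Unit) (ι ⊕ Unit) (FreeAlgebra ℚ X) :=
    Matrix.fromBlocks A (Matrix.of fun i _ => m i) (Matrix.of fun _ j => f j) 0 with hM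
  by_cases hfull : InnerRankGE M (Fintype.card (ι ⊕ Unit))
  · right
    obtain ⟨N, hMN, hNM⟩ := isUnit_iff_exists.mp (isUnit_map_of_innerRankGE hfull)
    set d := N (Sum.inr ()) (Sum.inr ()) with hd
    have h1 : d * -p = 1 := by
      have hc : ∀ j, ∑ i, N (Sum.inr ()) (Sum.inl i) * ofFree X (A i j) = -(d * ofFree X (f j)) := by
        intro j
        have h := congrFun (congrFun hNM (Sum.inr ())) (Sum.inl j)
        rw [Matrix.mul_apply, Fintype.sum_sum_type] at h
        simp only [hM, Matrix.map_apply, Matrix.fromBlocks_apply₁₁, Matrix.fromBlocks_apply₂₁,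
          Finset.univ_unique, PUnit.default_eq_unit, Finset.sum_singleton, Matrix.of_apply] at h
        rw [Matrix.one_apply_ne (by simp)] at h
        exact eq_neg_of_add_eq_zero_left h
      have h := congrFun (congrFun hNM (Sum.inr ())) (Sum.inr ())
      rw [Matrix.mul_apply, Fintype.sum_sum_type] at h
      simp only [hM, Matrix.map_apply, Matrix.fromBlocks_apply₁₂, Matrix.fromBlocks_apply₂₂,
        Matrix.zero_apply, map_zero, mul_zero, Finset.sum_const_zero, add_zero,
        Matrix.of_apply, Matrix.one_apply_eq] at h
      rw [← h, hp, mul_neg, Finset.mul_sum, ← Finset.sum_neg_distrib]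
      simp only [← hv, Finset.mul_sum]
      rw [Finset.sum_comm]
      refine Finset.sum_congr rfl fun j _ => ?_
      simp only [← mul_assoc]
      rw [← Finset.sum_mul, hc, neg_mul]
    have h2 : -p * d = 1 := by
      have hb : (fun i => N (Sum.inl i) (Sum.inr ())) = fun i => -(v i * d) := by
        have h : ∀ i, ∑ j, ofFree X (A i j) * (N (Sum.inl j) (Sum.inr ()) + v j * d) = 0 := by
          intro i
          have h := congrFun (congrFun hMN (Sum.inl i)) (Sum.inr ())
          rw [Matrix.mul_apply, Fintype.sum_sum_type] at h
          simp only [hM, Matrix.map_apply, Matrix.fromBlocks_apply₁₁, Matrix.fromBlocks_apply₁₂,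
            Finset.univ_unique, PUnit.default_eq_unit, Finset.sum_singleton, Matrix.of_apply] at h
          rw [Matrix.one_apply_ne (by simp)] at h
          simp only [mul_add, Finset.sum_add_distrib, ← mul_assoc]
          rw [← Finset.sum_mul, hv, h]
        have h' : Matrix.mulVec (A.map (ofFree X))
            (fun j => N (Sum.inl j) (Sum.inr ()) + v j * d) = 0 := funext h
        have h3 := congrArg (Matrix.mulVec A') h'
        rw [Matrix.mulVec_mulVec, hA', Matrix.one_mulVec, Matrix.mulVec_zero] at h3
        exact funext fun i => eq_neg_of_add_eq_zero_left (congrFun h3 i)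
      have h := congrFun (congrFun hMN (Sum.inr ())) (Sum.inr ())
      rw [Matrix.mul_apply, Fintype.sum_sum_type] at h
      simp only [hM, Matrix.map_apply, Matrix.fromBlocks_apply₂₁, Matrix.fromBlocks_apply₂₂,
        Matrix.zero_apply, map_zero, zero_mul, Finset.sum_const_zero, add_zero,
        Matrix.of_apply, Matrix.one_apply_eq] at h
      rw [← h, hp, neg_mul, Finset.sum_mul, ← Finset.sum_neg_distrib]
      refine Finset.sum_congr rfl fun i _ => ?_
      rw [congrFun hb i, mul_neg, mul_assoc]
    have : IsUnit (-p) := isUnit_iff_exists.mpr ⟨d, h2, h1⟩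
    simpa using this
  · left
    unfold InnerRankGE at hfull
    push Not at hfull
    obtain ⟨r, P, S, hPS, hr⟩ := hfull
    rw [Fintype.card_sum, Fintype.card_unit] at hr
    have hA1 : A = P.submatrix Sum.inl id * S.submatrix id Sum.inl := by
      ext i j
      exact congrFun (congrFun hPS (Sum.inl i)) (Sum.inl j)
    -- Fullness of `A` leaves only `r = card ι`. The upper part of `P` is then square and full,
    -- hence invertible over the skew field, and can be cancelled from `A v = m`.
    have hle : Fintype.card ι ≤ r := hA r _ _ hA1
    have hcard : Fintype.card ι = Fintype.card (Fin r) := by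
      rw [Fintype.card_fin]
      omega
    let e : ι ≃ Fin r := Fintype.equivOfCardEq hcard
    set P1 : Matrix ι ι (FreeAlgebra ℚ X) := P.submatrix Sum.inl e with hP1
    have hP1full : InnerRankGE P1 (Fintype.card ι) :=
      (InnerRankGE.left_of_mul (hA1 ▸ hA :)).submatrix_equiv (Equiv.refl ι) e
    obtain ⟨B, -, hB⟩ := isUnit_iff_exists.mp (isUnit_map_of_innerRankGE hP1full)
    have hm : ∀ i, m i = ∑ l, P (Sum.inl i) l * S l (Sum.inr ()) := fun i => by
      have := congrFun (congrFun hPS (Sum.inl i)) (Sum.inr ())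
      rwa [Matrix.mul_apply] at this
    have hf : ∀ j, f j = ∑ l, P (Sum.inr ()) l * S l (Sum.inl j) := fun j => by
      have := congrFun (congrFun hPS (Sum.inr ())) (Sum.inl j)
      rwa [Matrix.mul_apply] at this
    have h0 : ∑ l, P (Sum.inr ()) l * S l (Sum.inr ()) = 0 := by
      have := congrFun (congrFun hPS (Sum.inr ())) (Sum.inr ())
      rw [Matrix.mul_apply] at this
      exact this.symm
    have hS : ∀ l, ∑ j, ofFree X (S l (Sum.inl j)) * v j = ofFree X (S l (Sum.inr ())) := by
      have h : ∀ i, ∑ l, ofFree X (P (Sum.inl i) l) *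
          (∑ j, ofFree X (S l (Sum.inl j)) * v j - ofFree X (S l (Sum.inr ()))) = 0 := by
        intro i
        simp only [mul_sub, Finset.sum_sub_distrib, Finset.mul_sum]
        rw [Finset.sum_comm, sub_eq_zero]
        have h2 := hv i
        rw [hm, map_sum] at h2
        simp only [map_mul] at h2
        rw [← h2]
        refine Finset.sum_congr rfl fun j _ => ?_
        rw [hA1, Matrix.mul_apply, map_sum, Finset.sum_mul]
        simp only [map_mul, mul_assoc, Matrix.submatrix_apply, id_eq]
      have h' : Matrix.mulVec (P1.map (ofFree X)) (fun l =>
          ∑ j, ofFree X (S (e l) (Sum.inl j)) * v j - ofFree X (S (e l) (Sum.inr ()))) = 0 := by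
        ext1 i
        rw [Matrix.mulVec, dotProduct]
        exact (Equiv.sum_comp e (fun l => ofFree X (P (Sum.inl i) l) *
          (∑ j, ofFree X (S l (Sum.inl j)) * v j - ofFree X (S l (Sum.inr ()))))).trans (h i)
      have h3 := congrArg (Matrix.mulVec B) h'
      rw [Matrix.mulVec_mulVec, hB, Matrix.one_mulVec, Matrix.mulVec_zero] at h3
      intro l
      have := congrFun h3 (e.symm l)
      simp only [Equiv.apply_symm_apply] at this
      exact sub_eq_zero.mp this
    rw [hp]
    simp only [hf, map_sum, map_mul, Finset.sum_mul, mul_assoc]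
    rw [Finset.sum_comm]
    simp only [← Finset.mul_sum, hS, ← map_mul]
    rw [← map_sum, h0, map_zero]

theorem injective_of_nontrivial {S : Type v} [Ring S] [Algebra ℚ S] [Nontrivial S]
    (f : FreeSkewField X →ₐ[ℚ] S) : Function.Injective f := by
  rw [injective_iff_map_eq_zero]
  intro a ha
  refine (eq_zero_or_isUnit a).resolve_right fun h => ?_
  have := h.map f
  rw [ha] at this
  exact not_isUnit_zero this

end FreeSkewField

/-! ### Saturation of submodules at full matrices -/

section Saturation

variable {X : Type u} {M : Type w} [AddCommGroup M] [Module (FreeAlgebra ℚ X) M]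

/-- The elements of `M` which occur in linear combinations of the entries of vectors that some full
matrix maps into `N`. -/
def fullSaturation (N : Submodule (FreeAlgebra ℚ X) M) : Submodule (FreeAlgebra ℚ X) M where
  carrier := {x | ∃ (ι : Type) (_ : Fintype ι) (B : Matrix ι ι (FreeAlgebra ℚ X))
    (y : ι → M) (c : ι → FreeAlgebra ℚ X), InnerRankGE B (Fintype.card ι) ∧
    (∀ i, ∑ j, B i j • y j ∈ N) ∧ x = ∑ i, c i • y i}
  zero_mem' := ⟨Empty, inferInstance, 0, Empty.elim, Empty.elim,
    fun m _ _ _ => by simp, fun i => i.elim, by simp⟩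
  add_mem' := by
    rintro _ _ ⟨ι, _, A, x, c, hA, hx, rfl⟩ ⟨κ, _, B, y, d, hB, hy, rfl⟩
    refine ⟨ι ⊕ κ, inferInstance, Matrix.fromBlocks A 0 0 B, Sum.elim x y, Sum.elim c d, ?_, ?_, ?_⟩
    · rw [Fintype.card_sum]
      exact FreeAlgebra.innerRankGE_fromBlocks hA hB 0
    · rintro (i | i)
      · simpa using hx i
      · simpa using hy i
    · simp
  smul_mem' := by
    rintro a _ ⟨ι, _, A, x, c, hA, hx, rfl⟩
    exact ⟨ι, _, A, x, fun i => a * c i, hA, hx, by simp [Finset.smul_sum, mul_smul]⟩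

theorem le_fullSaturation (N : Submodule (FreeAlgebra ℚ X) M) : N ≤ fullSaturation N := by
  intro x hx
  exact ⟨Unit, inferInstance, 1, fun _ => x, fun _ => 1, FreeAlgebra.innerRankGE_one,
    by simpa using hx, by simp⟩

/-- Finitely many elements of the saturation have a common denominator. -/
theorem exists_common_denominator {N : Submodule (FreeAlgebra ℚ X) M} {n : ℕ} {x : Fin n → M}
    (hx : ∀ i, x i ∈ fullSaturation N) :
    ∃ (κ : Type) (_ : Fintype κ) (B : Matrix κ κ (FreeAlgebra ℚ X)) (y : κ → M)
      (C : Fin n → κ → FreeAlgebra ℚ X), InnerRankGE B (Fintype.card κ) ∧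
      (∀ i, ∑ j, B i j • y j ∈ N) ∧ ∀ i, x i = ∑ j, C i j • y j := by
  classical
  choose κ hκ B y c hB hy hc using hx
  refine ⟨Σ i, κ i, inferInstance, Matrix.blockDiagonal' B, fun k => y k.1 k.2,
    fun i k => if i = k.1 then c k.1 k.2 else 0, FreeAlgebra.innerRankGE_blockDiagonal' B hB, ?_, ?_⟩
  · rintro ⟨i, k⟩
    rw [Fintype.sum_sigma, Finset.sum_eq_single i]
    · simpa using hy i k
    · intro i' _ hi'
      refine Finset.sum_eq_zero fun k' _ => ?_
      rw [Matrix.blockDiagonal'_apply_ne B _ _ (Ne.symm hi'), zero_smul]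
    · simp
  · intro i
    rw [hc, Fintype.sum_sigma, Finset.sum_eq_single i]
    · simp
    · intro i' _ hi'
      simp [Ne.symm hi']
    · simp

/-- Write `A x = C y` with `B y` in `N` and `B` full. The full block triangular matrix with blocks
`A`, `-C`, `0`, `B` maps `(x, y)` to `(0, B y)`, so saturating once is enough. -/
theorem mem_fullSaturation_of_full {N : Submodule (FreeAlgebra ℚ X) M} {n : ℕ}
    {A : Matrix (Fin n) (Fin n) (FreeAlgebra ℚ X)} (hA : IsFullMatrix A) {x : Fin n → M}
    (hx : ∀ i, ∑ j, A i j • x j ∈ fullSaturation N) (i : Fin n) : x i ∈ fullSaturation N := by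
  obtain ⟨κ, _, B, y, C, hB, hy, hC⟩ := exists_common_denominator hx
  refine ⟨Fin n ⊕ κ, inferInstance, Matrix.fromBlocks A (Matrix.of fun i j => -C i j) 0 B,
    Sum.elim x y, Sum.elim (Pi.single i 1) 0, ?_, ?_, ?_⟩
  · rw [Fintype.card_sum, Fintype.card_fin]
    exact FreeAlgebra.innerRankGE_fromBlocks hA hB _
  · rintro (k | k)
    · simp [hC]
    · simpa using hy k
  · simp [Pi.single_apply]

end Saturation

/-! ### A nonzero module on which all full matrices are invertible -/

section DivisibleModule

variable (X : Type u)

/-- A linear system with a full coefficient matrix. -/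
abbrev FullSystem : Type u :=
  Σ n : ℕ, {A : Matrix (Fin n) (Fin n) (FreeAlgebra ℚ X) // IsFullMatrix A} ×
    (Fin n → FreeAlgebra ℚ X)

/-- The free module on a distinguished element and the unknowns of all full linear systems. -/
abbrev UnknownsModule : Type u := Option (Σ p : FullSystem X, Fin p.1) →₀ FreeAlgebra ℚ X

variable {X}

/-- The equations of a full linear system. -/
noncomputable def systemRel (s : Σ p : FullSystem X, Fin p.1) : UnknownsModule X :=
  ∑ j, Finsupp.single (some ⟨s.1, j⟩) (s.1.2.1.1 s.2 j) - Finsupp.single none (s.1.2.2 s.2)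

variable (X) in
/-- The submodule spanned by the equations of all full linear systems. -/
noncomputable def systemRels : Submodule (FreeAlgebra ℚ X) (UnknownsModule X) :=
  Submodule.span _ (Set.range systemRel)

theorem systemRel_none (s : Σ p : FullSystem X, Fin p.1) :
    systemRel s none = -s.1.2.2 s.2 := by
  simp [systemRel]

theorem systemRel_some_same (p : FullSystem X) (i j : Fin p.1) :
    systemRel ⟨p, i⟩ (some ⟨p, j⟩) = p.2.1.1 i j := by
  classical
  simp [systemRel, Finsupp.single_apply]

theorem systemRel_some_ne {p q : FullSystem X} (h : p ≠ q) (i : Fin p.1) (j : Fin q.1) :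
    systemRel ⟨p, i⟩ (some ⟨q, j⟩) = 0 := by
  classical
  simp [systemRel, h]

/-- Every finite set of relations lives on a single full system. -/
theorem exists_full_of_mem_systemRels {κ : Type*} [Fintype κ] {z : κ → UnknownsModule X}
    (hz : ∀ k, z k ∈ systemRels X) :
    ∃ (ι : Type u) (_ : Fintype ι) (A : Matrix ι ι (FreeAlgebra ℚ X)) (m : ι → FreeAlgebra ℚ X)
      (σ : ι → Σ p : FullSystem X, Fin p.1) (V : κ → ι → FreeAlgebra ℚ X),
      InnerRankGE A (Fintype.card ι) ∧ (∀ k i, z k (some (σ i)) = ∑ l, V k l * A l i) ∧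
      ∀ k, z k none = -∑ l, V k l * m l := by
  classical
  choose V hV using fun k => Finsupp.mem_span_range_iff_exists_finsupp.mp (hz k)
  let s : Finset (FullSystem X) := Finset.univ.biUnion fun k => (V k).support.image Sigma.fst
  let σ : (Σ p : s, Fin p.1.1) ↪ Σ p : FullSystem X, Fin p.1 :=
    ⟨fun x => ⟨x.1.1, x.2⟩, by
      rintro ⟨⟨p, hp⟩, i⟩ ⟨⟨q, hq⟩, j⟩ h
      cases h
      rfl⟩
  have hz' : ∀ k, z k = ∑ i, V k (σ i) • systemRel (σ i) := by
    intro k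
    rw [← hV k, Finsupp.sum_of_support_subset (s := Finset.univ.map σ)]
    · rw [Finset.sum_map]
    · intro x hx
      rw [Finset.mem_map]
      exact ⟨⟨⟨x.1, Finset.mem_biUnion.mpr ⟨k, Finset.mem_univ _, Finset.mem_image_of_mem _ hx⟩⟩,
        x.2⟩, Finset.mem_univ _, rfl⟩
    · simp
  refine ⟨Σ p : s, Fin p.1.1, inferInstance, Matrix.blockDiagonal' fun p : s => p.1.2.1.1,
    fun x => x.1.1.2.2 x.2, σ, fun k i => V k (σ i), ?_, ?_, ?_⟩
  · refine FreeAlgebra.innerRankGE_blockDiagonal' _ fun p => ?_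
    rw [Fintype.card_fin]
    exact p.1.2.1.2
  · rintro k ⟨q, j⟩
    rw [hz' k, Finsupp.finsetSum_apply]
    refine Finset.sum_congr rfl ?_
    rintro ⟨p, i⟩ -
    rw [Finsupp.smul_apply, smul_eq_mul]
    congr 1
    by_cases h : p = q
    · subst h
      rw [Matrix.blockDiagonal'_apply_eq]
      exact systemRel_some_same p.1 i j
    · rw [Matrix.blockDiagonal'_apply_ne _ _ _ h]
      exact systemRel_some_ne (fun h' => h (Subtype.ext h')) i j
  · intro k
    rw [hz' k, Finsupp.finsetSum_apply, ← Finset.sum_neg_distrib]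
    refine Finset.sum_congr rfl ?_
    rintro ⟨p, i⟩ -
    rw [Finsupp.smul_apply, smul_eq_mul, systemRel_none, mul_neg]
    rfl

/-- A membership would read `c y = e` for the generator `e`, with `B` full and `B y` a combination
`V` of equations of one full system `(A, m)`. Comparing coordinates gives `P * S = 0`, `P t = 0`, `e
S = 0` and `e t = 1` for the block matrices and vectors below, where `e` now denotes the row `(c,
0)`. Trivializing `P * S = 0` yields `e t = 0`. -/
theorem single_none_notMem :
    Finsupp.single none 1 ∉ fullSaturation (systemRels X) := by
  classical
  rintro ⟨κ, _, B, y, c, hB, hy, hc⟩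
  obtain ⟨ι, _, A, m, σ, V, hA, hsome, hnone⟩ := exists_full_of_mem_systemRels hy
  set P : Matrix κ (κ ⊕ ι) (FreeAlgebra ℚ X) := Matrix.fromCols B (Matrix.of fun k i => -V k i)
    with hP
  set S : Matrix (κ ⊕ ι) ι (FreeAlgebra ℚ X) :=
    Matrix.fromRows (Matrix.of fun k i => y k (some (σ i))) A with hS
  set t : κ ⊕ ι → FreeAlgebra ℚ X := Sum.elim (fun k => y k none) (fun i => -m i) with ht
  set e : κ ⊕ ι → FreeAlgebra ℚ X := Sum.elim c 0 with he
  have hPS : P * S = 0 := by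
    ext k i
    have h := hsome k i
    simp only [Finsupp.finsetSum_apply, Finsupp.smul_apply, smul_eq_mul] at h
    simp [hP, hS, Matrix.mul_apply, h]
  have hPt : Matrix.mulVec P t = 0 := by
    ext1 k
    have h := hnone k
    simp only [Finsupp.finsetSum_apply, Finsupp.smul_apply, smul_eq_mul] at h
    simp [hP, ht, Matrix.mulVec, dotProduct, h]
  have heS : Matrix.vecMul e S = 0 := by
    ext1 i
    have h := DFunLike.congr_fun hc (some (σ i))
    rw [Finsupp.single_eq_of_ne (by simp)] at h
    simp only [Finsupp.finsetSum_apply, Finsupp.smul_apply, smul_eq_mul] at h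
    simp [he, hS, Matrix.vecMul, dotProduct, ← h]
  have het : e ⬝ᵥ t = 1 := by
    have h := DFunLike.congr_fun hc none
    rw [Finsupp.single_eq_same] at h
    simp only [Finsupp.finsetSum_apply, Finsupp.smul_apply, smul_eq_mul] at h
    simp [he, ht, dotProduct, ← h]
  obtain ⟨T, T', hT, hz⟩ := FreeAlgebra.exists_trivialization P S hPS
  set s : Finset (κ ⊕ ι) := Finset.univ.filter fun i => ∀ j, (T * S) i j = 0 with hs
  have hPz : ∀ i, i ∉ s → ∀ k, (P * T') k i = 0 := fun i hi => (hz i).resolve_right (by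
    simpa [hs] using hi)
  have hSz : ∀ i, i ∈ s → ∀ j, (T * S) i j = 0 := fun i hi => by simpa [hs] using hi
  have hBf : B = (P * T') * T.submatrix id Sum.inl := by
    have : (P * T' * T).submatrix id Sum.inl = B := by
      rw [Matrix.mul_assoc, hT, Matrix.mul_one]
      rfl
    rw [← this]
    rfl
  have hAf : A = T'.submatrix Sum.inr id * (T * S) := by
    have : (T' * (T * S)).submatrix Sum.inr id = A := by
      rw [← Matrix.mul_assoc, hT, Matrix.one_mul]
      rfl
    rw [← this]
    rfl
  -- Fullness of `B` and `A` bounds the two parts of the middle index set from below. The bounds add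
  -- up to its whole size, so both are equalities.
  have h1 : Fintype.card κ ≤ s.card :=
    hB.le_card_finset _ _ hBf s fun i hi => Or.inl (hPz i hi)
  have h2 : Fintype.card ι ≤ sᶜ.card :=
    hA.le_card_finset _ _ hAf sᶜ fun i hi => Or.inr (hSz i (by simpa using hi))
  have h3 := s.card_add_card_compl
  rw [Fintype.card_sum] at h3
  have hBf' : B = (P * T').submatrix id (Subtype.val : s → κ ⊕ ι) *
      T.submatrix (Subtype.val : s → κ ⊕ ι) Sum.inl := by
    conv_lhs => rw [hBf]
    ext k j
    rw [Matrix.mul_apply, Matrix.mul_apply]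
    simp only [Matrix.submatrix_apply, id_eq]
    rw [Finset.sum_coe_sort s (fun i => (P * T') k i * T i (Sum.inl j))]
    refine (Finset.sum_subset (Finset.subset_univ s) fun i _ hi => ?_).symm
    rw [hPz i hi, zero_mul]
  have hAf' : A = T'.submatrix Sum.inr (Subtype.val : (sᶜ : Finset (κ ⊕ ι)) → κ ⊕ ι) *
      (T * S).submatrix (Subtype.val : (sᶜ : Finset (κ ⊕ ι)) → κ ⊕ ι) id := by
    conv_lhs => rw [hAf]
    ext k j
    rw [Matrix.mul_apply, Matrix.mul_apply]
    simp only [Matrix.submatrix_apply, id_eq]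
    rw [Finset.sum_coe_sort sᶜ (fun i => T' (Sum.inr k) i * (T * S) i j)]
    refine (Finset.sum_subset (Finset.subset_univ _) fun i _ hi => ?_).symm
    rw [hSz i (by simpa using hi), mul_zero]
  -- The nonzero columns of `P * T'` now form a matrix of maximal inner rank, which can be cancelled
  -- from `P t = 0`; dually for the rows of `T * S` and `e S = 0` below.
  have hTt : ∀ i ∈ s, Matrix.mulVec T t i = 0 := by
    have hfull : InnerRankGE ((P * T').submatrix id (Subtype.val : s → κ ⊕ ι)) (Fintype.card s) := by
      rw [Fintype.card_coe, show s.card = Fintype.card κ by omega]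
      exact (hBf' ▸ hB : InnerRankGE (_ * _) _).left_of_mul
    have h := FreeAlgebra.eq_zero_of_mulVec_eq_zero hfull
      (v := fun i => Matrix.mulVec T t i) (by
        have h4 : Matrix.mulVec (P * T') (Matrix.mulVec T t) = 0 := by
          rw [Matrix.mulVec_mulVec, Matrix.mul_assoc, hT, Matrix.mul_one, hPt]
        ext1 k
        refine Eq.trans ?_ (congrFun h4 k)
        simp only [Matrix.mulVec, dotProduct, Matrix.submatrix_apply, id_eq]
        rw [Finset.sum_coe_sort s (fun i => (P * T') k i * ∑ j, T i j * t j)]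
        refine Finset.sum_subset (Finset.subset_univ s) fun i _ hi => ?_
        rw [hPz i hi, zero_mul])
    exact fun i hi => congrFun h ⟨i, hi⟩
  have heT : ∀ i, i ∉ s → Matrix.vecMul e T' i = 0 := by
    have hfull : InnerRankGE ((T * S).submatrix (Subtype.val : (sᶜ : Finset (κ ⊕ ι)) → κ ⊕ ι) id)
        (Fintype.card (sᶜ : Finset (κ ⊕ ι))) := by
      rw [Fintype.card_coe, show sᶜ.card = Fintype.card ι by omega]
      exact (hAf' ▸ hA : InnerRankGE (_ * _) _).right_of_mul
    have h := FreeAlgebra.eq_zero_of_vecMul_eq_zero hfull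
      (v := fun i => Matrix.vecMul e T' i) (by
        have h4 : Matrix.vecMul (Matrix.vecMul e T') (T * S) = 0 := by
          rw [Matrix.vecMul_vecMul, ← Matrix.mul_assoc, hT, Matrix.one_mul, heS]
        ext1 k
        refine Eq.trans ?_ (congrFun h4 k)
        simp only [Matrix.vecMul, dotProduct, Matrix.submatrix_apply, id_eq]
        rw [Finset.sum_coe_sort sᶜ (fun i => (∑ j, e j * T' j i) * (T * S) i k)]
        refine Finset.sum_subset (Finset.subset_univ _) fun i _ hi => ?_
        rw [hSz i (by simpa using hi), mul_zero])
    exact fun i hi => congrFun h ⟨i, by simpa using hi⟩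
  have h0 : e ⬝ᵥ t = 0 := by
    have h5 : e ⬝ᵥ t = Matrix.vecMul e T' ⬝ᵥ Matrix.mulVec T t := by
      rw [← Matrix.dotProduct_mulVec, Matrix.mulVec_mulVec, hT, Matrix.one_mulVec]
    rw [h5]
    refine Finset.sum_eq_zero fun i _ => ?_
    by_cases hi : i ∈ s
    · rw [hTt i hi, mul_zero]
    · rw [heT i hi, zero_mul]
  rw [het] at h0
  exact one_ne_zero h0

/-- Modulo the equations, the unknowns of each system are carried by its full matrix into multiples
of the distinguished generator. -/
theorem fullSaturation_sup_eq_top :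
    fullSaturation (systemRels X ⊔ Submodule.span _ {Finsupp.single none 1}) = ⊤ := by
  rw [eq_top_iff]
  intro x _
  induction x using Finsupp.induction_linear with
  | zero => exact zero_mem _
  | add x y hx hy => exact add_mem (hx trivial) (hy trivial)
  | single a r =>
    rw [← mul_one r, ← smul_eq_mul, ← Finsupp.smul_single]
    refine Submodule.smul_mem _ _ ?_
    cases a with
    | none =>
      exact le_fullSaturation _ (Submodule.mem_sup_right (Submodule.mem_span_singleton_self _))
    | some a =>
      obtain ⟨p, i⟩ := a
      refine mem_fullSaturation_of_full p.2.1.2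
        (x := fun j => (Finsupp.single (some ⟨p, j⟩) 1 : UnknownsModule X))
        (fun l => le_fullSaturation _ ?_) i
      have h : ∑ j, p.2.1.1 l j • (Finsupp.single (some ⟨p, j⟩) 1 : UnknownsModule X) =
          systemRel ⟨p, l⟩ + p.2.2 l • Finsupp.single none 1 := by
        simp [systemRel]
      rw [h]
      exact add_mem (Submodule.mem_sup_left (Submodule.subset_span ⟨_, rfl⟩))
        (Submodule.smul_mem _ _ (Submodule.mem_sup_right (Submodule.mem_span_singleton_self _)))

/-- Full linear systems can be solved modulo the saturation of the relations. -/
theorem exists_solution {n : ℕ} {A : Matrix (Fin n) (Fin n) (FreeAlgebra ℚ X)} (hA : IsFullMatrix A)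
    (g : Fin n → UnknownsModule X) :
    ∃ x : Fin n → UnknownsModule X,
      ∀ i, ∑ j, A i j • x j - g i ∈ fullSaturation (systemRels X) := by
  classical
  obtain ⟨κ, _, B, y, C, hB, hy, hC⟩ := exists_common_denominator
    (x := g) (N := systemRels X ⊔ Submodule.span _ {Finsupp.single none 1})
    (fun i => by rw [fullSaturation_sup_eq_top]; trivial)
  have hm : ∀ k, ∃ m : FreeAlgebra ℚ X,
      ∑ j, B k j • y j - m • Finsupp.single none 1 ∈ systemRels X := by
    intro k
    obtain ⟨a, ha, b, hb, hab⟩ := Submodule.mem_sup.mp (hy k)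
    obtain ⟨m, rfl⟩ := Submodule.mem_span_singleton.mp hb
    exact ⟨m, by rwa [← hab, add_sub_cancel_right]⟩
  choose m hm using hm
  -- Write `g = C y`, where `B y` is `m` times the generator modulo the equations. Then `A x = g`
  -- becomes part of one full system with scalar right side `(0, m)`, whose unknowns are available
  -- in the module.
  let E : Matrix (Fin n ⊕ κ) (Fin n ⊕ κ) (FreeAlgebra ℚ X) :=
    Matrix.fromBlocks A (Matrix.of fun i j => -C i j) 0 B
  have hE : InnerRankGE E (Fintype.card (Fin n ⊕ κ)) := by
    rw [Fintype.card_sum, Fintype.card_fin]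
    exact FreeAlgebra.innerRankGE_fromBlocks hA hB _
  let e := Fintype.equivFin (Fin n ⊕ κ)
  let p : FullSystem X := ⟨Fintype.card (Fin n ⊕ κ), ⟨E.submatrix e.symm e.symm,
    hE.submatrix_equiv e.symm e.symm⟩, fun i => Sum.elim 0 m (e.symm i)⟩
  let x : Fin n ⊕ κ → UnknownsModule X := fun i => Finsupp.single (some ⟨p, e i⟩) 1
  have hx : ∀ i, ∑ j, E i j • x j - (Sum.elim 0 m i : FreeAlgebra ℚ X) • Finsupp.single none 1 ∈
      systemRels X := by
    intro i
    have h : systemRel ⟨p, e i⟩ ∈ systemRels X := Submodule.subset_span ⟨_, rfl⟩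
    convert h using 1
    unfold systemRel
    congr 1
    · rw [← Equiv.sum_comp e]
      refine Finset.sum_congr rfl fun j _ => ?_
      simp [p, x]
    · simp [p]
  -- The new unknowns and `y` satisfy the same equations with full matrix `B`, so they agree modulo
  -- the saturation.
  have hxr : ∀ k, x (Sum.inr k) - y k ∈ fullSaturation (systemRels X) := by
    let f := Fintype.equivFin κ
    have h := mem_fullSaturation_of_full (N := systemRels X)
      (A := B.submatrix f.symm f.symm) (hB.submatrix_equiv f.symm f.symm)
      (x := fun l => x (Sum.inr (f.symm l)) - y (f.symm l)) (fun i => by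
        refine le_fullSaturation _ ?_
        have h1 := sub_mem (hx (Sum.inr (f.symm i))) (hm (f.symm i))
        rw [Fintype.sum_sum_type] at h1
        simp only [E, Matrix.fromBlocks_apply₂₁, Matrix.fromBlocks_apply₂₂, Matrix.zero_apply,
          zero_smul, Finset.sum_const_zero, zero_add, Sum.elim_inr, sub_sub_sub_cancel_right] at h1
        rw [← Finset.sum_sub_distrib] at h1
        simp only [← smul_sub] at h1
        rwa [← Equiv.sum_comp f.symm] at h1)
    intro k
    simpa using h (f k)
  refine ⟨fun i => x (Sum.inl i), fun i => ?_⟩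
  have h1 := le_fullSaturation _ (hx (Sum.inl i))
  have h2 : ∑ k, C i k • (x (Sum.inr k) - y k) ∈ fullSaturation (systemRels X) :=
    sum_mem fun k _ => Submodule.smul_mem _ _ (hxr k)
  have h3 := add_mem h1 h2
  convert h3 using 1
  rw [Fintype.sum_sum_type]
  simp only [E, Matrix.fromBlocks_apply₁₁, Matrix.fromBlocks_apply₁₂, Matrix.of_apply, neg_smul,
    Finset.sum_neg_distrib, Sum.elim_inl, Pi.zero_apply, zero_smul, sub_zero, smul_sub,
    Finset.sum_sub_distrib, ← hC]
  abel

/-- A nonzero module over the free algebra on which all full matrices are invertible. -/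
abbrev DivisibleModule (X : Type u) : Type u := UnknownsModule X ⧸ fullSaturation (systemRels X)

instance : Nontrivial (DivisibleModule X) :=
  ⟨⟨Submodule.Quotient.mk (Finsupp.single none 1), 0, fun h =>
    single_none_notMem ((Submodule.Quotient.mk_eq_zero _).mp h)⟩⟩

/-- As an endomorphism of column vectors, `A` is injective because the saturation is closed under
division by full matrices, and surjective by `exists_solution`. -/
theorem isUnit_lsmul_divisibleModule {n : ℕ} {A : Matrix (Fin n) (Fin n) (FreeAlgebra ℚ X)}
    (hA : IsFullMatrix A) : IsUnit (A.map (Algebra.lsmul ℚ ℚ (DivisibleModule X))) := by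
  let e := endVecRingEquivMatrixEnd (Fin n) ℚ (DivisibleModule X)
  have h : IsUnit (e.symm (A.map (Algebra.lsmul ℚ ℚ (DivisibleModule X)))) := by
    rw [Module.End.isUnit_iff]
    have happ : ∀ x i, e.symm (A.map (Algebra.lsmul ℚ ℚ (DivisibleModule X))) x i =
        ∑ j, A i j • x j := by
      intro x i
      rfl
    constructor
    · rw [← LinearMap.ker_eq_bot, LinearMap.ker_eq_bot']
      intro x hx
      choose y hy using fun i => Submodule.Quotient.mk_surjective _ (x i)
      ext1 i
      rw [← hy]
      refine (Submodule.Quotient.mk_eq_zero _).mpr (mem_fullSaturation_of_full hA (fun i => ?_) i)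
      rw [← Submodule.Quotient.mk_eq_zero]
      have := congrFun hx i
      rw [happ] at this
      simp only [← hy, ← Submodule.Quotient.mk_smul] at this
      rw [← Submodule.mkQ_apply, map_sum]
      exact this
    · intro z
      choose g hg using fun i => Submodule.Quotient.mk_surjective _ (z i)
      obtain ⟨x, hx⟩ := exists_solution hA g
      refine ⟨fun i => Submodule.Quotient.mk (x i), ?_⟩
      ext1 i
      rw [happ, ← hg, ← (Submodule.Quotient.eq _).mpr (hx i), ← Submodule.mkQ_apply, map_sum]
      rfl
  simpa using h.map e

end DivisibleModule

/-- The free skew field acts on the nonzero divisible module, that is, maps to its nonzero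
endomorphism ring. -/
instance FreeSkewField.instNontrivial (X : Type u) : Nontrivial (FreeSkewField X) := by
  obtain ⟨g, -⟩ := FreeSkewField.exists_extension (Algebra.lsmul ℚ ℚ (DivisibleModule X))
    (fun n A hA => isUnit_lsmul_divisibleModule hA)
  exact g.toRingHom.domain_nontrivial

/-! ### Derivations of the free skew field -/

/-- Upper triangular `2 × 2` matrices. -/
def upperTriangular (B : Type v) [Ring B] [Algebra ℚ B] : Subalgebra ℚ (Matrix (Fin 2) (Fin 2) B) where
  carrier := {M | M 1 0 = 0}
  mul_mem' := by
    intro M N hM hN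
    simp only [Set.mem_ofPred_eq] at hM hN ⊢
    simp [Matrix.mul_apply, Fin.sum_univ_two, hM, hN]
  add_mem' := by
    intro M N hM hN
    simp only [Set.mem_ofPred_eq] at hM hN ⊢
    simp [hM, hN]
  algebraMap_mem' := by
    intro r
    simp [Matrix.algebraMap_matrix_apply]

namespace upperTriangular

variable {B : Type v} [Ring B] [Algebra ℚ B]

/-- The upper triangular matrix with given entries. -/
def mk (a b c : B) : upperTriangular B := ⟨!![a, b; 0, c], by simp [upperTriangular]⟩

/-- The upper left entry. -/
def fst : upperTriangular B →ₐ[ℚ] B where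
  toFun M := M.1 0 0
  map_one' := by simp
  map_zero' := by simp
  map_add' M N := by simp
  map_mul' M N := by
    have h : N.1 1 0 = 0 := N.2
    simp [Matrix.mul_apply, Fin.sum_univ_two, h]
  commutes' r := by simp [Matrix.algebraMap_matrix_apply]

/-- The lower right entry. -/
def snd : upperTriangular B →ₐ[ℚ] B where
  toFun M := M.1 1 1
  map_one' := by simp
  map_zero' := by simp
  map_add' M N := by simp
  map_mul' M N := by
    have h : M.1 1 0 = 0 := M.2
    simp [Matrix.mul_apply, Fin.sum_univ_two, h]
  commutes' r := by simp [Matrix.algebraMap_matrix_apply]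

/-- The upper right entry. -/
def off : upperTriangular B →ₗ[ℚ] B where
  toFun M := M.1 0 1
  map_add' M N := by simp
  map_smul' r M := by simp

@[simp] theorem fst_mk (a b c : B) : fst (mk a b c) = a := rfl

@[simp] theorem snd_mk (a b c : B) : snd (mk a b c) = c := rfl

@[simp] theorem off_mk (a b c : B) : off (mk a b c) = b := rfl

theorem off_mul (M N : upperTriangular B) : off (M * N) = fst M * off N + off M * snd N := by
  change (M.1 * N.1) 0 1 = M.1 0 0 * N.1 0 1 + M.1 0 1 * N.1 1 1
  rw [Matrix.mul_apply, Fin.sum_univ_two]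

theorem off_one : off (1 : upperTriangular B) = 0 := by
  change (1 : Matrix (Fin 2) (Fin 2) B) 0 1 = 0
  simp

theorem ext {M N : upperTriangular B} (h₁ : fst M = fst N) (h₂ : off M = off N)
    (h₃ : snd M = snd N) : M = N := by
  apply Subtype.ext
  ext i j
  fin_cases i <;> fin_cases j
  · exact h₁
  · exact h₂
  · exact (M.2 : M.1 1 0 = 0).trans (N.2 : N.1 1 0 = 0).symm
  · exact h₃

/-- A matrix of upper triangular matrices is invertible if its diagonal parts are. -/
theorem isUnit_matrix {n : ℕ} {A : Matrix (Fin n) (Fin n) (upperTriangular B)}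
    (h₁ : IsUnit (A.map fst)) (h₂ : IsUnit (A.map snd)) : IsUnit A := by
  obtain ⟨L, hL1, hL2⟩ := isUnit_iff_exists.mp h₁
  obtain ⟨R, hR1, hR2⟩ := isUnit_iff_exists.mp h₂
  set D : Matrix (Fin n) (Fin n) B := A.map off with hD
  -- This is the inverse of a block triangular matrix with diagonal inverses `L`, `R` and
  -- off-diagonal block `D`.
  set C : Matrix (Fin n) (Fin n) (upperTriangular B) :=
    Matrix.of fun i j => mk (L i j) ((-(L * D * R)) i j) (R i j) with hC
  have hC1 : C.map fst = L := rfl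
  have hC2 : C.map snd = R := rfl
  have hC3 : C.map off = -(L * D * R) := rfl
  have hfst : ∀ M N : Matrix (Fin n) (Fin n) (upperTriangular B),
      (M * N).map fst = M.map fst * N.map fst := fun M N => Matrix.map_mul
  have hsnd : ∀ M N : Matrix (Fin n) (Fin n) (upperTriangular B),
      (M * N).map snd = M.map snd * N.map snd := fun M N => Matrix.map_mul
  have hoff : ∀ M N : Matrix (Fin n) (Fin n) (upperTriangular B),
      (M * N).map off = M.map fst * N.map off + M.map off * N.map snd := by
    intro M N
    ext i j
    simp only [Matrix.map_apply, Matrix.mul_apply, Matrix.add_apply, map_sum, off_mul,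
      Finset.sum_add_distrib]
  have hext : ∀ M : Matrix (Fin n) (Fin n) (upperTriangular B), M.map fst = 1 → M.map off = 0 →
      M.map snd = 1 → M = 1 := by
    intro M h1 h2 h3
    ext1 i j
    have e1 : fst (M i j) = _ := congrFun (congrFun h1 i) j
    have e2 : off (M i j) = _ := congrFun (congrFun h2 i) j
    have e3 : snd (M i j) = _ := congrFun (congrFun h3 i) j
    by_cases hij : i = j
    · subst hij
      rw [Matrix.one_apply_eq] at e1 e3 ⊢
      exact ext (e1.trans (map_one fst).symm) (e2.trans off_one.symm) (e3.trans (map_one snd).symm)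
    · rw [Matrix.one_apply_ne hij] at e1 e3 ⊢
      exact ext (e1.trans (map_zero fst).symm) (e2.trans (map_zero off).symm)
        (e3.trans (map_zero snd).symm)
  refine isUnit_iff_exists.mpr ⟨C, hext _ ?_ ?_ ?_, hext _ ?_ ?_ ?_⟩
  · rw [hfst, hC1, hL1]
  · rw [hoff, hC3, hC2, Matrix.mul_neg, Matrix.mul_assoc L, ← Matrix.mul_assoc _ L, hL1,
      Matrix.one_mul, neg_add_cancel]
  · rw [hsnd, hC2, hR1]
  · rw [hfst, hC1, hL2]
  · rw [hoff, hC1, hC3, Matrix.neg_mul, Matrix.mul_assoc _ R, hR2, Matrix.mul_one, ← hD,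
      add_neg_cancel]
  · rw [hsnd, hC2, hR2]

end upperTriangular

/-- `d` is a derivation for the bimodule structure given by the homomorphisms `l` and `r`. -/
def IsDerivationAlong {A : Type u} {B : Type v} [Ring A] [Algebra ℚ A] [Ring B] [Algebra ℚ B]
    (l r : A →ₐ[ℚ] B) (d : A →ₗ[ℚ] B) : Prop :=
  ∀ a b, d (a * b) = l a * d b + d a * r b

/-- The homomorphism to upper triangular matrices given by a derivation. -/
def IsDerivationAlong.toAlgHom {A : Type u} {B : Type v} [Ring A] [Algebra ℚ A] [Ring B]
    [Algebra ℚ B] {l r : A →ₐ[ℚ] B} {d : A →ₗ[ℚ] B} (hd : IsDerivationAlong l r d) :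
    A →ₐ[ℚ] upperTriangular B :=
  AlgHom.ofLinearMap
    { toFun := fun a => upperTriangular.mk (l a) (d a) (r a)
      map_add' := fun a b => upperTriangular.ext (by simp) (by simp) (by simp)
      map_smul' := fun a b => upperTriangular.ext (by simp) (by simp) (by simp) }
    (by
      refine upperTriangular.ext (by simp) ?_ (by simp)
      have h := hd 1 1
      simp only [map_one, one_mul, mul_one] at h
      rw [upperTriangular.off_one]
      simpa using h)
    (fun a b => upperTriangular.ext (by simp)
      (by rw [upperTriangular.off_mul]; simp [hd a b]) (by simp))

namespace FreeSkewField

variable {X : Type u} {B : Type v} [Ring B] [Algebra ℚ B]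

/-- The values of a derivation on the variables are arbitrary. -/
theorem exists_derivationAlong (l r : FreeSkewField X →ₐ[ℚ] B) (c : X → B) :
    ∃ d : FreeSkewField X →ₗ[ℚ] B, IsDerivationAlong l r d ∧ ∀ x, d (gen x) = c x := by
  let f : FreeAlgebra ℚ X →ₐ[ℚ] upperTriangular B :=
    FreeAlgebra.lift ℚ fun x => upperTriangular.mk (l (gen x)) (c x) (r (gen x))
  have hf1 : upperTriangular.fst.comp f = l.comp (ofFree X) := by
    refine FreeAlgebra.hom_ext (funext fun x => ?_)
    simp [f, gen]
  have hf2 : upperTriangular.snd.comp f = r.comp (ofFree X) := by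
    refine FreeAlgebra.hom_ext (funext fun x => ?_)
    simp [f, gen]
  obtain ⟨g, hg⟩ := exists_extension f fun n A hA => by
    refine upperTriangular.isUnit_matrix ?_ ?_
    · have h := (isUnit_map_ofFree hA).map l.mapMatrix
      convert h using 1
      ext i j
      exact DFunLike.congr_fun hf1 (A i j)
    · have h := (isUnit_map_ofFree hA).map r.mapMatrix
      convert h using 1
      ext i j
      exact DFunLike.congr_fun hf2 (A i j)
  have hgx : ∀ x, g (gen x) = upperTriangular.mk (l (gen x)) (c x) (r (gen x)) := by
    intro x
    rw [gen, hg]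
    simp [f, gen]
  have hg1 : upperTriangular.fst.comp g = l := algHom_ext fun x => by simp [hgx]
  have hg2 : upperTriangular.snd.comp g = r := algHom_ext fun x => by simp [hgx]
  refine ⟨upperTriangular.off ∘ₗ g.toLinearMap, fun a b => ?_, fun x => by simp [hgx]⟩
  rw [← hg1, ← hg2]
  simp [upperTriangular.off_mul]

/-- A derivation is determined by its values on the variables. -/
theorem derivationAlong_ext {l r : FreeSkewField X →ₐ[ℚ] B} {d e : FreeSkewField X →ₗ[ℚ] B}
    (hd : IsDerivationAlong l r d) (he : IsDerivationAlong l r e)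
    (h : ∀ x, d (gen x) = e (gen x)) : d = e := by
  have h1 : hd.toAlgHom = he.toAlgHom := algHom_ext fun x =>
    upperTriangular.ext rfl (h x) rfl
  ext a
  exact congrArg upperTriangular.off (DFunLike.congr_fun h1 a)

end FreeSkewField

/-! ### Biderivations -/

/-- A bilinear map with the derivation properties of a double bracket, along two homomorphisms. -/
structure IsBiderivation {A₁ : Type u} {A₂ : Type v} {B : Type w} [Ring A₁] [Algebra ℚ A₁]
    [Ring A₂] [Algebra ℚ A₂] [Ring B] [Algebra ℚ B] (φ : A₁ →ₐ[ℚ] B) (ψ : A₂ →ₐ[ℚ] B)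
    (β : A₁ →ₗ[ℚ] A₂ →ₗ[ℚ] B ⊗[ℚ] B) : Prop where
  right : ∀ a b c, β a (b * c) = (ψ b ⊗ₜ[ℚ] 1) * β a c + β a b * (1 ⊗ₜ[ℚ] ψ c)
  left : ∀ a b c, β (a * b) c = (1 ⊗ₜ[ℚ] φ a) * β b c + β a c * (φ b ⊗ₜ[ℚ] 1)

section Biderivation

variable {A₁ : Type u} {A₂ : Type v} {B : Type w} [Ring A₁] [Algebra ℚ A₁]
  [Ring A₂] [Algebra ℚ A₂] [Ring B] [Algebra ℚ B] {φ : A₁ →ₐ[ℚ] B} {ψ : A₂ →ₐ[ℚ] B}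

/-- Skew symmetry turns the outer Leibniz rule in the second argument into the inner one in the
first. -/
theorem IsDoubleBracket.isBiderivation {br : B →ₗ[ℚ] B →ₗ[ℚ] B ⊗[ℚ] B} (h : IsDoubleBracket br)
    (φ : A₁ →ₐ[ℚ] B) (ψ : A₂ →ₐ[ℚ] B) :
    IsBiderivation φ ψ (br.compl₁₂ φ.toLinearMap ψ.toLinearMap) where
  right a b c := by
    simp only [LinearMap.compl₁₂_apply, AlgHom.toLinearMap_apply, map_mul]
    rw [h.leibniz, add_comm]
  left a b c := by
    simp only [LinearMap.compl₁₂_apply, AlgHom.toLinearMap_apply, map_mul]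
    have hτ : ∀ x y : B ⊗[ℚ] B, TensorProduct.comm ℚ B B (x * y) =
        TensorProduct.comm ℚ B B x * TensorProduct.comm ℚ B B y :=
      fun x y => map_mul (Algebra.TensorProduct.comm ℚ B B) x y
    rw [h.skew (ψ c) (φ a * φ b), h.leibniz, map_add, hτ, hτ, h.skew (ψ c) (φ a),
      h.skew (ψ c) (φ b)]
    simp only [TensorProduct.comm_tmul]
    simp only [neg_add_rev, mul_neg, neg_mul]

theorem IsDoubleBracket.isBiderivation_id {br : B →ₗ[ℚ] B →ₗ[ℚ] B ⊗[ℚ] B}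
    (h : IsDoubleBracket br) : IsBiderivation (AlgHom.id ℚ B) (AlgHom.id ℚ B) br :=
  h.isBiderivation (AlgHom.id ℚ B) (AlgHom.id ℚ B)

theorem IsBiderivation.isDoubleBracket {br : B →ₗ[ℚ] B →ₗ[ℚ] B ⊗[ℚ] B}
    (h : IsBiderivation (AlgHom.id ℚ B) (AlgHom.id ℚ B) br)
    (hs : ∀ a b : B, br b a = -(TensorProduct.comm ℚ B B (br a b))) : IsDoubleBracket br where
  leibniz a b c := (h.right a b c).trans (add_comm _ _)
  skew := hs

theorem IsBiderivation.map {C : Type*} [Ring C] [Algebra ℚ C] {β : A₁ →ₗ[ℚ] A₂ →ₗ[ℚ] B ⊗[ℚ] B}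
    (h : IsBiderivation φ ψ β) (f : B →ₐ[ℚ] C) :
    IsBiderivation (f.comp φ) (f.comp ψ)
      (β.compr₂ (Algebra.TensorProduct.map f f).toLinearMap) where
  right a b c := by
    simp only [LinearMap.compr₂_apply, AlgHom.toLinearMap_apply, h.right, map_add, map_mul,
      Algebra.TensorProduct.map_tmul, map_one, AlgHom.comp_apply]
  left a b c := by
    simp only [LinearMap.compr₂_apply, AlgHom.toLinearMap_apply, h.left, map_add, map_mul,
      Algebra.TensorProduct.map_tmul, map_one, AlgHom.comp_apply]

theorem IsBiderivation.zero : IsBiderivation φ ψ 0 where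
  right a b c := by simp
  left a b c := by simp

/-- Skew symmetry says that a biderivation equals this transform of itself; as both are
biderivations, it can be tested on variables. -/
theorem IsBiderivation.neg_comm_flip {β : A₁ →ₗ[ℚ] A₂ →ₗ[ℚ] B ⊗[ℚ] B}
    (h : IsBiderivation φ ψ β) :
    IsBiderivation ψ φ (-(β.flip.compr₂ (TensorProduct.comm ℚ B B).toLinearMap)) := by
  have hτ : ∀ x y : B ⊗[ℚ] B, TensorProduct.comm ℚ B B (x * y) =
      TensorProduct.comm ℚ B B x * TensorProduct.comm ℚ B B y :=
    fun x y => map_mul (Algebra.TensorProduct.comm ℚ B B) x y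
  constructor
  · intro a b c
    simp only [LinearMap.neg_apply, LinearMap.compr₂_apply, LinearMap.flip_apply,
      LinearEquiv.coe_coe, h.left, map_add, hτ, TensorProduct.comm_tmul, neg_add_rev, mul_neg,
      neg_mul]
    abel
  · intro a b c
    simp only [LinearMap.neg_apply, LinearMap.compr₂_apply, LinearMap.flip_apply,
      LinearEquiv.coe_coe, h.right, map_add, hτ, TensorProduct.comm_tmul, neg_add_rev, mul_neg,
      neg_mul]
    abel

end Biderivation

namespace FreeSkewField

variable {X : Type u} {Y : Type v} {B : Type w} [Ring B] [Algebra ℚ B]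

theorem biderivation_ext {φ : FreeSkewField X →ₐ[ℚ] B} {ψ : FreeSkewField Y →ₐ[ℚ] B}
    {β γ : FreeSkewField X →ₗ[ℚ] FreeSkewField Y →ₗ[ℚ] B ⊗[ℚ] B}
    (hβ : IsBiderivation φ ψ β) (hγ : IsBiderivation φ ψ γ)
    (h : ∀ x y, β (gen x) (gen y) = γ (gen x) (gen y)) : β = γ := by
  let L : B →ₐ[ℚ] B ⊗[ℚ] B := Algebra.TensorProduct.includeLeft
  let R : B →ₐ[ℚ] B ⊗[ℚ] B := Algebra.TensorProduct.includeRight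
  have h1 : ∀ x, β (gen x) = γ (gen x) := fun x =>
    derivationAlong_ext (l := L.comp ψ) (r := R.comp ψ)
      (fun a b => hβ.right (gen x) a b) (fun a b => hγ.right (gen x) a b) (h x)
  have h2 : ∀ b, β.flip b = γ.flip b := fun b =>
    derivationAlong_ext (l := R.comp φ) (r := L.comp φ)
      (fun a a' => hβ.left a a' b) (fun a a' => hγ.left a a' b)
      (fun x => DFunLike.congr_fun (h1 x) b)
  ext a b
  exact DFunLike.congr_fun (h2 b) a

/-- Extend `c x` to a derivation `D x` in the second argument, then for each `b` extend `x ↦ D x b`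
to a derivation `E b` in the first. Dependence on `b` is controlled by uniqueness of derivations. -/
theorem exists_biderivation (c : X → X → FreeSkewField X ⊗[ℚ] FreeSkewField X) :
    ∃ β : FreeSkewField X →ₗ[ℚ] FreeSkewField X →ₗ[ℚ] FreeSkewField X ⊗[ℚ] FreeSkewField X,
      IsBiderivation (AlgHom.id ℚ (FreeSkewField X)) (AlgHom.id ℚ (FreeSkewField X)) β ∧
        ∀ x y, β (gen x) (gen y) = c x y := by
  let L : FreeSkewField X →ₐ[ℚ] FreeSkewField X ⊗[ℚ] FreeSkewField X :=
    Algebra.TensorProduct.includeLeft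
  let R : FreeSkewField X →ₐ[ℚ] FreeSkewField X ⊗[ℚ] FreeSkewField X :=
    Algebra.TensorProduct.includeRight
  have hLR : ∀ a b, L a * R b = R b * L a := fun a b => by
    simp [L, R, Algebra.TensorProduct.tmul_mul_tmul]
  choose D hD hDc using fun x => exists_derivationAlong L R (c x)
  choose E hE hED using fun b => exists_derivationAlong R L (fun x => D x b)
  have hEadd : ∀ b b', E (b + b') = E b + E b' := fun b b' =>
    derivationAlong_ext (hE _) (fun a a' => by
      simp only [LinearMap.add_apply, hE b a a', hE b' a a', mul_add, add_mul]
      abel) (fun x => by simp [hED])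
  have hEsmul : ∀ (q : ℚ) b, E (q • b) = q • E b := fun q b =>
    derivationAlong_ext (hE _) (fun a a' => by
      simp only [LinearMap.smul_apply, hE b a a', smul_add, mul_smul_comm, smul_mul_assoc])
      (fun x => by simp [hED])
  -- The right side is a derivation in the first argument because the outer and inner bimodule
  -- structures commute (`hLR`).
  have hEmul : ∀ b b', E (b * b') =
      LinearMap.mulLeft ℚ (L b) ∘ₗ E b' + LinearMap.mulRight ℚ (R b') ∘ₗ E b := fun b b' =>
    derivationAlong_ext (hE _) (fun a a' => by
      simp only [LinearMap.add_apply, LinearMap.comp_apply, LinearMap.mulLeft_apply,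
        LinearMap.mulRight_apply, hE b a a', hE b' a a', mul_add, add_mul]
      rw [← mul_assoc (L b), hLR, mul_assoc (E b a), hLR]
      simp only [mul_assoc]
      abel) (fun x => by simp [hED, hD x b b'])
  refine ⟨LinearMap.mk₂ ℚ (fun a b => E b a) (fun a a' b => map_add _ _ _)
    (fun q a b => map_smul _ _ _) (fun a b b' => by rw [hEadd]; rfl)
    (fun q a b => by rw [hEsmul]; rfl), ⟨fun a b b' => ?_, fun a a' b => ?_⟩, fun x y => ?_⟩
  · simp only [LinearMap.mk₂_apply, hEmul]
    rfl
  · exact hE b a a'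
  · simp only [LinearMap.mk₂_apply, hED, hDc]

/-- Double brackets with given values on pairs of variables exist. -/
theorem exists_doubleBracket (c : X → X → FreeSkewField X ⊗[ℚ] FreeSkewField X)
    (hc : ∀ x y, c y x = -(TensorProduct.comm ℚ _ _ (c x y))) :
    ∃ br : FreeSkewField X →ₗ[ℚ] FreeSkewField X →ₗ[ℚ] FreeSkewField X ⊗[ℚ] FreeSkewField X,
      IsDoubleBracket br ∧ ∀ x y, br (gen x) (gen y) = c x y := by
  obtain ⟨β, hβ, hβc⟩ := exists_biderivation c
  refine ⟨β, hβ.isDoubleBracket fun a b => ?_, hβc⟩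
  have h := biderivation_ext hβ hβ.neg_comm_flip fun x y => by
    simp [hβc, hc y x]
  exact DFunLike.congr_fun (DFunLike.congr_fun h b) a

theorem doubleBracket_ext
    {br br' : FreeSkewField X →ₗ[ℚ] FreeSkewField X →ₗ[ℚ] FreeSkewField X ⊗[ℚ] FreeSkewField X}
    (h : IsDoubleBracket br) (h' : IsDoubleBracket br')
    (hx : ∀ x y, br (gen x) (gen y) = br' (gen x) (gen y)) : br = br' :=
  biderivation_ext h.isBiderivation_id h'.isBiderivation_id hx

end FreeSkewField

/-! ### Local double brackets -/

theorem TensorProduct.comm_algebraMap_map {A : Type u} {B : Type v} [Ring A] [Algebra ℚ A] [Ring B]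
    [Algebra ℚ B] (f : A →ₐ[ℚ] B) (t : A ⊗[ℚ] A) :
    TensorProduct.comm ℚ B B (Algebra.TensorProduct.map f f t) =
      Algebra.TensorProduct.map f f (TensorProduct.comm ℚ A A t) := by
  induction t using TensorProduct.induction_on with
  | zero => simp only [map_zero]
  | tmul a b => rfl
  | add s t hs ht => simp only [map_add, hs, ht]

namespace FreeSkewField

/-- On three variables, double brackets with zero values on the diagonal are given by their values
on three pairs. -/
theorem existsUnique_doubleBracket_three {X : Type u} {x y z : X} (hxy : x ≠ y) (hxz : x ≠ z)
    (hyz : y ≠ z) (hall : ∀ h, h = x ∨ h = y ∨ h = z)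
    (vxy vxz vyz : FreeSkewField X ⊗[ℚ] FreeSkewField X) :
    ∃! br : FreeSkewField X →ₗ[ℚ] FreeSkewField X →ₗ[ℚ] FreeSkewField X ⊗[ℚ] FreeSkewField X,
      IsDoubleBracket br ∧ (∀ h, br (gen h) (gen h) = 0) ∧ br (gen x) (gen y) = vxy ∧
        br (gen x) (gen z) = vxz ∧ br (gen y) (gen z) = vyz := by
  classical
  have hττ : ∀ t : FreeSkewField X ⊗[ℚ] FreeSkewField X, TensorProduct.comm ℚ _ _
      (TensorProduct.comm ℚ (FreeSkewField X) (FreeSkewField X) t) = t := fun t =>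
    (TensorProduct.comm ℚ (FreeSkewField X) (FreeSkewField X)).symm_apply_apply t
  let c : X → X → FreeSkewField X ⊗[ℚ] FreeSkewField X := fun h h' =>
    if h = x ∧ h' = y then vxy else if h = y ∧ h' = x then -(TensorProduct.comm ℚ _ _ vxy)
    else if h = x ∧ h' = z then vxz else if h = z ∧ h' = x then -(TensorProduct.comm ℚ _ _ vxz)
    else if h = y ∧ h' = z then vyz else if h = z ∧ h' = y then -(TensorProduct.comm ℚ _ _ vyz)
    else 0
  have hc : ∀ h h', c h' h = -(TensorProduct.comm ℚ _ _ (c h h')) := by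
    intro h h'
    rcases hall h with rfl | rfl | rfl <;> rcases hall h' with rfl | rfl | rfl <;>
      simp [c, hττ, hxy, hxz, hyz, hxy.symm, hxz.symm, hyz.symm]
  obtain ⟨br, hbr, hbrc⟩ := exists_doubleBracket c hc
  refine ⟨br, ⟨hbr, ?_, ?_, ?_, ?_⟩, ?_⟩
  · intro h
    rw [hbrc]
    rcases hall h with rfl | rfl | rfl <;>
      simp [c, hxy, hxz, hyz, hxy.symm, hxz.symm, hyz.symm]
  · simp [hbrc, c]
  · simp [hbrc, c, hxy, hyz.symm]
  · simp [hbrc, c, hxy.symm, hxz.symm]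
  · rintro br' ⟨hbr', h0, h1, h2, h3⟩
    refine doubleBracket_ext hbr' hbr fun h h' => ?_
    rcases hall h with rfl | rfl | rfl <;> rcases hall h' with rfl | rfl | rfl <;>
      (first
        | rw [h0] | rw [h1] | rw [h2] | rw [h3]
        | rw [hbr'.skew, h1] | rw [hbr'.skew, h2] | rw [hbr'.skew, h3]) <;>
      simp [hbrc, c, hxy, hxz, hyz, hxy.symm, hxz.symm, hyz.symm]

end FreeSkewField

/-! ### Half-edges at a vertex -/

/-- Half-edges are arrows with a choice of an end. -/
def HalfEdge.equivSum (E : Type u) : HalfEdge E ≃ E ⊕ E where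
  toFun
    | .s α => .inl α
    | .t α => .inr α
  invFun
    | .inl α => .s α
    | .inr α => .t α
  left_inv h := by cases h <;> rfl
  right_inv h := by cases h <;> rfl

instance HalfEdge.instFinite (E : Type u) [Finite E] : Finite (HalfEdge E) :=
  Finite.of_equiv _ (HalfEdge.equivSum E).symm

namespace PerfectQuiver

variable {V E : Type u} (Q : PerfectQuiver V E) {p : V}

/-- The half-edges at a vertex are the outgoing and the incoming arrows. -/
def starEquivSum (p : V) : Q.Star p ≃ {α // Q.source α = p} ⊕ {α // Q.target α = p} where
  toFun
    | ⟨.s α, h⟩ => .inl ⟨α, h⟩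
    | ⟨.t α, h⟩ => .inr ⟨α, h⟩
  invFun
    | .inl α => ⟨.s α.1, α.2⟩
    | .inr α => ⟨.t α.1, α.2⟩
  left_inv := by rintro ⟨_ | _, _⟩ <;> rfl
  right_inv := by rintro (_ | _) <;> rfl

theorem card_star [Finite E] (p : V) :
    Nat.card (Q.Star p) = {α | Q.source α = p}.ncard + {α | Q.target α = p}.ncard := by
  rw [Nat.card_congr (Q.starEquivSum p), Nat.card_sum]
  rfl

theorem exists_iterate_next [Finite E] (h h' : Q.Star p) : ∃ n : ℕ, Q.next^[n] h = h' := by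
  obtain ⟨n, hn⟩ := (Q.rot_cyclic h.1 h'.1 (h.2.trans h'.2.symm)).exists_nat_pow_eq
  refine ⟨n, Subtype.ext ?_⟩
  rw [← hn]
  clear hn
  induction n with
  | zero => rfl
  | succ n ih =>
    rw [Function.iterate_succ_apply', pow_succ', Equiv.Perm.mul_apply, ← ih]
    rfl

/-- At a trivalent vertex, a half-edge and its two successors are all the half-edges. -/
theorem star_trivalent [Finite E] (h3 : Nat.card (Q.Star p) = 3) (h : Q.Star p) :
    h ≠ Q.next h ∧ h ≠ Q.next (Q.next h) ∧ Q.next h ≠ Q.next (Q.next h) ∧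
      ∀ h', h' = h ∨ h' = Q.next h ∨ h' = Q.next (Q.next h) := by
  classical
  have hcard : ∀ s : Finset (Q.Star p), (∀ h', h' ∈ s) → 3 ≤ s.card := by
    intro s hs
    have := Fintype.ofFinite (Q.Star p)
    rw [← h3, Nat.card_eq_fintype_card, ← Finset.card_univ]
    exact Finset.card_le_card fun h' _ => hs h'
  -- The rotation has a single cycle at the vertex, so a set closed under `next` is everything; this
  -- excludes cycles of length one and two.
  have hclosed : ∀ s : Finset (Q.Star p), h ∈ s → (∀ h' ∈ s, Q.next h' ∈ s) → 3 ≤ s.card := by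
    intro s h0 hs
    refine hcard s fun h' => ?_
    obtain ⟨n, rfl⟩ := Q.exists_iterate_next h h'
    induction n with
    | zero => exact h0
    | succ n ih =>
      rw [Function.iterate_succ_apply']
      exact hs _ ih
  have h1 : h ≠ Q.next h := by
    intro h1
    have := hclosed {h} (by simp) (by simpa using h1.symm)
    simp at this
  have h2 : h ≠ Q.next (Q.next h) := by
    intro h2
    have := hclosed {h, Q.next h} (by simp) (by simp [← h2])
    have h4 := Finset.card_le_two (a := h) (b := Q.next h)
    omega
  have h12 : Q.next h ≠ Q.next (Q.next h) := by
    intro h12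
    exact h1 (Subtype.ext (Q.rot.injective (congrArg Subtype.val h12)))
  refine ⟨h1, h2, h12, fun h' => ?_⟩
  have := Fintype.ofFinite (Q.Star p)
  have huniv : ({h, Q.next h, Q.next (Q.next h)} : Finset (Q.Star p)) = Finset.univ := by
    rw [← Finset.card_eq_iff_eq_univ, ← Nat.card_eq_fintype_card, h3,
      Finset.card_eq_three.mpr ⟨_, _, _, h1, h2, h12, rfl⟩]
  have := Finset.mem_univ h'
  rw [← huniv] at this
  simpa using this

theorem exists_unique_target (hk : Q.kind p = .white) :
    ∃ α, Q.target α = p ∧ ∀ β, Q.target β = p → β = α := by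
  obtain ⟨α, hα⟩ := Set.ncard_eq_one.mp (Q.white_in p hk)
  exact ⟨α, (hα.symm ▸ Set.mem_singleton α : α ∈ {α | Q.target α = p}), fun β hβ =>
    Set.mem_singleton_iff.mp (hα ▸ (hβ : β ∈ {α | Q.target α = p}))⟩

theorem exists_unique_source (hk : Q.kind p = .black) :
    ∃ α, Q.source α = p ∧ ∀ β, Q.source β = p → β = α := by
  obtain ⟨α, hα⟩ := Set.ncard_eq_one.mp (Q.black_out p hk)
  exact ⟨α, (hα.symm ▸ Set.mem_singleton α : α ∈ {α | Q.source α = p}), fun β hβ =>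
    Set.mem_singleton_iff.mp (hα ▸ (hβ : β ∈ {α | Q.source α = p}))⟩

theorem card_star_white [Finite E] (hk : Q.kind p = .white) : Nat.card (Q.Star p) = 3 := by
  rw [card_star, Q.white_in p hk, Q.white_out p hk]

theorem card_star_black [Finite E] (hk : Q.kind p = .black) : Nat.card (Q.Star p) = 3 := by
  rw [card_star, Q.black_in p hk, Q.black_out p hk]

variable {w₁ w₂ w₃ k₁ k₂ k₃ : ℚ}

open FreeSkewField in
theorem existsUnique_localBracket [Finite E] (w₁ w₂ w₃ k₁ k₂ k₃ : ℚ) (p : V) :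
    ∃! loc, Q.IsLocalBracket w₁ w₂ w₃ k₁ k₂ k₃ p loc := by
  rcases hk : Q.kind p with _ | _ | _
  · obtain ⟨α, hα, huniq⟩ := Q.exists_unique_target hk
    let hx : Q.Star p := ⟨.t α, hα⟩
    obtain ⟨hxy, hxz, hyz, hall⟩ := Q.star_trivalent (Q.card_star_white hk) hx
    obtain ⟨br, ⟨hbr, hself, hv⟩, hu⟩ := existsUnique_doubleBracket_three hxy hxz hyz hall
      (w₁ • (1 ⊗ₜ[ℚ] (gen hx * gen (Q.next hx))))
      (w₂ • (1 ⊗ₜ[ℚ] (gen hx * gen (Q.next (Q.next hx)))))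
      (w₃ • (gen (Q.next hx) ⊗ₜ[ℚ] gen (Q.next (Q.next hx))))
    refine ⟨br, ⟨hbr, hself, fun _ β hβ => ?_, fun h => ?_, fun h => ?_⟩, fun br' hbr' => ?_⟩
    · obtain rfl := huniq β hβ
      exact hv
    · rw [hk] at h
      cases h
    · rw [hk] at h
      cases h
    · exact hu br' ⟨hbr'.isDoubleBracket, hbr'.self, hbr'.white hk α hα⟩
  · obtain ⟨α, hα, huniq⟩ := Q.exists_unique_source hk
    let ha : Q.Star p := ⟨.s α, hα⟩
    obtain ⟨hac, hab, hcb, hall⟩ := Q.star_trivalent (Q.card_star_black hk) ha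
    -- The cyclic order is `a, c, b`, while the values are listed for `a, b, c`: hence `b` is the
    -- second successor of `a`.
    obtain ⟨br, ⟨hbr, hself, hv⟩, hu⟩ := existsUnique_doubleBracket_three hab hac hcb.symm
      (fun h => (hall h).imp_right Or.symm)
      (k₁ • ((gen (Q.next (Q.next ha)) * gen ha) ⊗ₜ[ℚ] 1))
      (k₂ • ((gen (Q.next ha) * gen ha) ⊗ₜ[ℚ] 1))
      (k₃ • (gen (Q.next ha) ⊗ₜ[ℚ] gen (Q.next (Q.next ha))))
    refine ⟨br, ⟨hbr, hself, fun h => ?_, fun _ β hβ => ?_, fun h => ?_⟩, fun br' hbr' => ?_⟩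
    · rw [hk] at h
      cases h
    · obtain rfl := huniq β hβ
      exact hv
    · rw [hk] at h
      cases h
    · exact hu br' ⟨hbr'.isDoubleBracket, hbr'.self, hbr'.black hk α hα⟩
  · refine ⟨0, ⟨⟨fun a b c => ?_, fun a b => ?_⟩, fun h => ?_, fun h => ?_, fun h => ?_,
      fun _ => rfl⟩, fun br' hbr' => hbr'.boundary hk⟩
    · simp
    · simp
    · simp
    · rw [hk] at h
      cases h
    · rw [hk] at h
      cases h

namespace IsLocalBracket

open FreeSkewField

variable {Q}
  {loc : FreeSkewField (Q.Star p) →ₗ[ℚ] FreeSkewField (Q.Star p) →ₗ[ℚ]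
    FreeSkewField (Q.Star p) ⊗[ℚ] FreeSkewField (Q.Star p)}

/-- This shape is independent of the kind of vertex, and stable under exchanging the arguments up to
the sign of `q`. Distinct incoming half-edges occur only at black vertices. -/
theorem apply_incoming [Finite E] (hloc : Q.IsLocalBracket w₁ w₂ w₃ k₁ k₂ k₃ p loc) {α β : E}
    (hα : Q.target α = p) (hβ : Q.target β = p) :
    ∃ q : ℚ, loc (gen ⟨.t α, hα⟩) (gen ⟨.t β, hβ⟩) =
      q • (gen ⟨.t β, hβ⟩ ⊗ₜ[ℚ] gen ⟨.t α, hα⟩) := by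
  by_cases hαβ : α = β
  · subst hαβ
    exact ⟨0, by rw [hloc.self, zero_smul]⟩
  rcases hk : Q.kind p with _ | _ | _
  · obtain ⟨γ, -, huniq⟩ := Q.exists_unique_target hk
    exact absurd ((huniq α hα).trans (huniq β hβ).symm) hαβ
  · obtain ⟨γ, hγ, -⟩ := Q.exists_unique_source hk
    obtain ⟨-, -, -, hall⟩ := Q.star_trivalent (Q.card_star_black hk) ⟨.s γ, hγ⟩
    obtain ⟨-, -, hbc⟩ := hloc.black hk γ hγ
    rcases hall ⟨.t α, hα⟩ with h | h | h
    · cases congrArg Subtype.val h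
    · rcases hall ⟨.t β, hβ⟩ with h' | h' | h'
      · cases congrArg Subtype.val h'
      · exact absurd (HalfEdge.t.inj (congrArg Subtype.val (h.trans h'.symm))) hαβ
      · refine ⟨-k₃, ?_⟩
        rw [h, h', hloc.isDoubleBracket.skew, hbc, map_smul, TensorProduct.comm_tmul, neg_smul]
    · rcases hall ⟨.t β, hβ⟩ with h' | h' | h'
      · cases congrArg Subtype.val h'
      · exact ⟨k₃, by rw [h, h', hbc]⟩
      · exact absurd (HalfEdge.t.inj (congrArg Subtype.val (h.trans h'.symm))) hαβ
  · exact ⟨0, by rw [hloc.boundary hk, zero_smul]; rfl⟩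

theorem apply_outgoing [Finite E] (hloc : Q.IsLocalBracket w₁ w₂ w₃ k₁ k₂ k₃ p loc) {α β : E}
    (hα : Q.source α = p) (hβ : Q.source β = p) :
    ∃ q : ℚ, loc (gen ⟨.s α, hα⟩) (gen ⟨.s β, hβ⟩) =
      q • (gen ⟨.s α, hα⟩ ⊗ₜ[ℚ] gen ⟨.s β, hβ⟩) := by
  by_cases hαβ : α = β
  · subst hαβ
    exact ⟨0, by rw [hloc.self, zero_smul]⟩
  rcases hk : Q.kind p with _ | _ | _
  · obtain ⟨γ, hγ, -⟩ := Q.exists_unique_target hk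
    obtain ⟨-, -, -, hall⟩ := Q.star_trivalent (Q.card_star_white hk) ⟨.t γ, hγ⟩
    obtain ⟨-, -, hyz⟩ := hloc.white hk γ hγ
    rcases hall ⟨.s α, hα⟩ with h | h | h
    · cases congrArg Subtype.val h
    · rcases hall ⟨.s β, hβ⟩ with h' | h' | h'
      · cases congrArg Subtype.val h'
      · exact absurd (HalfEdge.s.inj (congrArg Subtype.val (h.trans h'.symm))) hαβ
      · exact ⟨w₃, by rw [h, h', hyz]⟩
    · rcases hall ⟨.s β, hβ⟩ with h' | h' | h'
      · cases congrArg Subtype.val h'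
      · refine ⟨-w₃, ?_⟩
        rw [h, h', hloc.isDoubleBracket.skew, hyz, map_smul, TensorProduct.comm_tmul, neg_smul]
      · exact absurd (HalfEdge.s.inj (congrArg Subtype.val (h.trans h'.symm))) hαβ
  · obtain ⟨γ, -, huniq⟩ := Q.exists_unique_source hk
    exact absurd ((huniq α hα).trans (huniq β hβ).symm) hαβ
  · exact ⟨0, by rw [hloc.boundary hk, zero_smul]; rfl⟩

/-- White vertices have this shape by definition, black ones after applying skew symmetry to the
given values. -/
theorem apply_incoming_outgoing [Finite E] (hloc : Q.IsLocalBracket w₁ w₂ w₃ k₁ k₂ k₃ p loc)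
    {α β : E} (hα : Q.target α = p) (hβ : Q.source β = p) :
    ∃ q : ℚ, loc (gen ⟨.t α, hα⟩) (gen ⟨.s β, hβ⟩) =
      q • (1 ⊗ₜ[ℚ] (gen ⟨.t α, hα⟩ * gen ⟨.s β, hβ⟩)) := by
  rcases hk : Q.kind p with _ | _ | _
  · obtain ⟨-, -, -, hall⟩ := Q.star_trivalent (Q.card_star_white hk) ⟨.t α, hα⟩
    obtain ⟨hxy, hxz, -⟩ := hloc.white hk α hα
    rcases hall ⟨.s β, hβ⟩ with h | h | h
    · cases congrArg Subtype.val h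
    · exact ⟨w₁, by rw [h, hxy]⟩
    · exact ⟨w₂, by rw [h, hxz]⟩
  · obtain ⟨-, -, -, hall⟩ := Q.star_trivalent (Q.card_star_black hk) ⟨.s β, hβ⟩
    obtain ⟨hab, hac, -⟩ := hloc.black hk β hβ
    rcases hall ⟨.t α, hα⟩ with h | h | h
    · cases congrArg Subtype.val h
    · refine ⟨-k₂, ?_⟩
      rw [h, hloc.isDoubleBracket.skew, hac, map_smul, TensorProduct.comm_tmul, neg_smul]
    · refine ⟨-k₁, ?_⟩
      rw [h, hloc.isDoubleBracket.skew, hab, map_smul, TensorProduct.comm_tmul, neg_smul]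
  · exact ⟨0, by rw [hloc.boundary hk, zero_smul]; rfl⟩

end IsLocalBracket

end PerfectQuiver

/-! ### The double bracket of the half-edges -/

namespace PerfectQuiver

open FreeSkewField

variable {V E : Type u} (Q : PerfectQuiver V E) {w₁ w₂ w₃ k₁ k₂ k₃ : ℚ}

theorem star_gen (p : V) (h : Q.Star p) : Q.star p (gen h) = gen h.1 :=
  incl_gen _ _ h

/-- The values on pairs of half-edges are forced: the local ones at a common vertex, zero otherwise.
Restriction and vanishing on all elements follow since both sides are biderivations agreeing on
variables. -/
theorem existsUnique_halfEdgeBracket [Finite E] (w₁ w₂ w₃ k₁ k₂ k₃ : ℚ) :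
    ∃! brH, Q.IsHalfEdgeBracket w₁ w₂ w₃ k₁ k₂ k₃ brH := by
  classical
  choose loc hloc hlocu using Q.existsUnique_localBracket w₁ w₂ w₃ k₁ k₂ k₃
  let c : HalfEdge E → HalfEdge E →
      FreeSkewField (HalfEdge E) ⊗[ℚ] FreeSkewField (HalfEdge E) := fun h h' =>
    if e : h'.vertex Q.source Q.target = h.vertex Q.source Q.target then
      Algebra.TensorProduct.map (Q.star _) (Q.star _) (loc _ (gen ⟨h, rfl⟩) (gen ⟨h', e⟩))
    else 0
  have hsame : ∀ p (a b : Q.Star p), c a.1 b.1 =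
      Algebra.TensorProduct.map (Q.star p) (Q.star p) (loc p (gen a) (gen b)) := by
    rintro p ⟨h, rfl⟩ b
    exact dif_pos b.2
  have hne : ∀ h h' : HalfEdge E, h.vertex Q.source Q.target ≠ h'.vertex Q.source Q.target →
      c h h' = 0 := fun h h' hh => dif_neg (Ne.symm hh)
  obtain ⟨br, hbr, hbrc⟩ := exists_doubleBracket c (fun h h' => by
    by_cases hh : h.vertex Q.source Q.target = h'.vertex Q.source Q.target
    · have h1 := hsame _ ⟨h, hh⟩ ⟨h', rfl⟩
      have h2 := hsame _ ⟨h', rfl⟩ ⟨h, hh⟩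
      dsimp only at h1 h2
      rw [h1, h2, TensorProduct.comm_algebraMap_map, ← map_neg, ← (hloc _).isDoubleBracket.skew]
    · rw [hne h h' hh, hne h' h (Ne.symm hh), map_zero, neg_zero])
  refine ⟨br, ⟨hbr, fun p => ⟨loc p, hloc p, fun a b => ?_⟩, fun p q hpq a b => ?_⟩,
    fun br' hbr' => ?_⟩
  · have h := biderivation_ext (hbr.isBiderivation (Q.star p) (Q.star p))
      ((hloc p).isDoubleBracket.isBiderivation_id.map (Q.star p)) fun x y => by
        simp only [LinearMap.compl₁₂_apply, LinearMap.compr₂_apply, AlgHom.toLinearMap_apply,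
          star_gen, hbrc, hsame]
    exact DFunLike.congr_fun (DFunLike.congr_fun h a) b
  · have h := biderivation_ext (hbr.isBiderivation (Q.star p) (Q.star q))
      IsBiderivation.zero fun x y => by
        simp only [LinearMap.compl₁₂_apply, AlgHom.toLinearMap_apply, star_gen, hbrc,
          LinearMap.zero_apply]
        exact hne _ _ (by rwa [x.2, y.2])
    exact DFunLike.congr_fun (DFunLike.congr_fun h a) b
  · refine doubleBracket_ext hbr'.isDoubleBracket hbr fun h h' => ?_
    rw [hbrc]
    by_cases hh : h.vertex Q.source Q.target = h'.vertex Q.source Q.target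
    · obtain ⟨loc', hloc', hr⟩ := hbr'.restrict (h'.vertex Q.source Q.target)
      have h1 := hr (gen ⟨h, hh⟩) (gen ⟨h', rfl⟩)
      rw [hlocu _ _ hloc', star_gen, star_gen] at h1
      exact h1.trans (hsame _ ⟨h, hh⟩ ⟨h', rfl⟩).symm
    · have h1 := hbr'.cross _ _ hh (gen ⟨h, rfl⟩) (gen ⟨h', rfl⟩)
      rw [star_gen, star_gen] at h1
      rw [hne h h' hh]
      exact h1

namespace IsHalfEdgeBracket

variable {Q}
  {brH : FreeSkewField (HalfEdge E) →ₗ[ℚ] FreeSkewField (HalfEdge E) →ₗ[ℚ]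
    FreeSkewField (HalfEdge E) ⊗[ℚ] FreeSkewField (HalfEdge E)}

theorem apply_of_vertex_ne (hbr : Q.IsHalfEdgeBracket w₁ w₂ w₃ k₁ k₂ k₃ brH) {h h' : HalfEdge E}
    (hh : h.vertex Q.source Q.target ≠ h'.vertex Q.source Q.target) :
    brH (gen h) (gen h') = 0 := by
  have h1 := hbr.cross _ _ hh (gen ⟨h, rfl⟩) (gen ⟨h', rfl⟩)
  rwa [star_gen, star_gen] at h1

theorem apply_incoming [Finite E] (hbr : Q.IsHalfEdgeBracket w₁ w₂ w₃ k₁ k₂ k₃ brH) (α β : E) :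
    ∃ q : ℚ, brH (gen (.t α)) (gen (.t β)) = q • (gen (.t β) ⊗ₜ[ℚ] gen (.t α)) := by
  by_cases h : Q.target α = Q.target β
  · obtain ⟨loc, hloc, hr⟩ := hbr.restrict (Q.target β)
    obtain ⟨q, hq⟩ := hloc.apply_incoming h rfl
    refine ⟨q, ?_⟩
    have h1 := hr (gen ⟨.t α, h⟩) (gen ⟨.t β, rfl⟩)
    rwa [hq, map_smul, Algebra.TensorProduct.map_tmul, star_gen, star_gen] at h1
  · exact ⟨0, by rw [hbr.apply_of_vertex_ne (h := .t α) (h' := .t β) h, zero_smul]⟩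

theorem apply_outgoing [Finite E] (hbr : Q.IsHalfEdgeBracket w₁ w₂ w₃ k₁ k₂ k₃ brH) (α β : E) :
    ∃ q : ℚ, brH (gen (.s α)) (gen (.s β)) = q • (gen (.s α) ⊗ₜ[ℚ] gen (.s β)) := by
  by_cases h : Q.source α = Q.source β
  · obtain ⟨loc, hloc, hr⟩ := hbr.restrict (Q.source β)
    obtain ⟨q, hq⟩ := hloc.apply_outgoing h rfl
    refine ⟨q, ?_⟩
    have h1 := hr (gen ⟨.s α, h⟩) (gen ⟨.s β, rfl⟩)
    rwa [hq, map_smul, Algebra.TensorProduct.map_tmul, star_gen, star_gen] at h1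
  · exact ⟨0, by rw [hbr.apply_of_vertex_ne (h := .s α) (h' := .s β) h, zero_smul]⟩

theorem apply_incoming_outgoing [Finite E] (hbr : Q.IsHalfEdgeBracket w₁ w₂ w₃ k₁ k₂ k₃ brH)
    (α β : E) :
    ∃ q : ℚ, brH (gen (.t α)) (gen (.s β)) = q • (1 ⊗ₜ[ℚ] (gen (.t α) * gen (.s β))) := by
  by_cases h : Q.target α = Q.source β
  · obtain ⟨loc, hloc, hr⟩ := hbr.restrict (Q.source β)
    obtain ⟨q, hq⟩ := hloc.apply_incoming_outgoing h rfl
    refine ⟨q, ?_⟩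
    have h1 := hr (gen ⟨.t α, h⟩) (gen ⟨.s β, rfl⟩)
    rwa [hq, map_smul, Algebra.TensorProduct.map_tmul, map_one, map_mul, star_gen, star_gen] at h1
  · exact ⟨0, by rw [hbr.apply_of_vertex_ne (h := .t α) (h' := .s β) h, zero_smul]⟩

/-- The bracket of two glued arrows comes from the free skew field of the arrows. -/
theorem exists_glue_eq [Finite E] (hbr : Q.IsHalfEdgeBracket w₁ w₂ w₃ k₁ k₂ k₃ brH) (α β : E) :
    ∃ t : FreeSkewField E ⊗[ℚ] FreeSkewField E,
      brH (glue E (gen α)) (glue E (gen β)) =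
        Algebra.TensorProduct.map (glue E) (glue E) t := by
  obtain ⟨q₁, h₁⟩ := hbr.apply_incoming α β
  obtain ⟨q₂, h₂⟩ := hbr.apply_outgoing α β
  obtain ⟨q₃, h₃⟩ := hbr.apply_incoming_outgoing α β
  obtain ⟨q₄, h₄⟩ := hbr.apply_incoming_outgoing β α
  -- One term for each pair of ends: target-target, source-source, target-source and source-target.
  -- The last is obtained from `h₄` by skew symmetry, whence the sign.
  refine ⟨q₁ • (gen β ⊗ₜ[ℚ] gen α) + q₂ • (gen α ⊗ₜ[ℚ] gen β) +
    q₃ • (1 ⊗ₜ[ℚ] (gen α * gen β)) - q₄ • ((gen β * gen α) ⊗ₜ[ℚ] 1), ?_⟩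
  have h₄' := hbr.isDoubleBracket.skew (gen (.t β)) (gen (.s α))
  rw [h₄, map_smul, TensorProduct.comm_tmul] at h₄'
  have hB := hbr.isDoubleBracket.isBiderivation_id
  rw [glue_gen, glue_gen, hB.left, hB.right, hB.right, h₁, h₂, h₃, h₄']
  simp only [map_add, map_sub, map_smul, Algebra.TensorProduct.map_tmul, map_one, map_mul, glue_gen,
    AlgHom.id_apply, mul_add, add_mul, mul_neg, neg_mul, mul_smul_comm, smul_mul_assoc,
    Algebra.TensorProduct.tmul_mul_tmul, one_mul, mul_one, mul_assoc]
  abel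

end IsHalfEdgeBracket

end PerfectQuiver

/-! ### The double bracket of the arrows -/

/-- A homomorphism from a ring whose nonzero elements are units to a nonzero ring is injective, and
tensoring over the field `ℚ` preserves this. -/
theorem map_glue_injective (E : Type u) :
    Function.Injective (Algebra.TensorProduct.map (glue E) (glue E)) := by
  have h := FreeSkewField.injective_of_nontrivial (glue E)
  exact TensorProduct.map_injective_of_flat_flat
    (glue E).toLinearMap (glue E).toLinearMap h h

theorem proposition11 {V E : Type u} [Finite V] [Finite E] (Q : PerfectQuiver V E)
    (w₁ w₂ w₃ k₁ k₂ k₃ : ℚ) :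
    (∀ p : V, ∃! loc, Q.IsLocalBracket w₁ w₂ w₃ k₁ k₂ k₃ p loc) ∧
    (∃! brH, Q.IsHalfEdgeBracket w₁ w₂ w₃ k₁ k₂ k₃ brH) ∧
    ∀ brH, Q.IsHalfEdgeBracket w₁ w₂ w₃ k₁ k₂ k₃ brH →
      ∃ brF : FreeSkewField E →ₗ[ℚ] FreeSkewField E →ₗ[ℚ] FreeSkewField E ⊗[ℚ] FreeSkewField E,
        IsDoubleBracket brF ∧
        (∀ a b : FreeSkewField E,
          brH (glue E a) (glue E b) =
            Algebra.TensorProduct.map (glue E) (glue E) (brF a b)) ∧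
        ∀ brF' : FreeSkewField E →ₗ[ℚ] FreeSkewField E →ₗ[ℚ] FreeSkewField E ⊗[ℚ] FreeSkewField E,
          IsDoubleBracket brF' →
          (∀ α β : E,
            brH (glue E (.gen α)) (glue E (.gen β)) =
              Algebra.TensorProduct.map (glue E) (glue E) (brF' (.gen α) (.gen β))) →
          brF' = brF := by
  refine ⟨Q.existsUnique_localBracket w₁ w₂ w₃ k₁ k₂ k₃,
    Q.existsUnique_halfEdgeBracket w₁ w₂ w₃ k₁ k₂ k₃, fun brH hbr => ?_⟩
  choose c hc using hbr.exists_glue_eq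
  obtain ⟨brF, hF, hFc⟩ := FreeSkewField.exists_doubleBracket c fun α β => by
    -- Skew symmetry of the chosen preimages is checked after applying `g* ⊗ g*`, where it is that
    -- of `brH`.
    apply map_glue_injective E
    rw [← hc, map_neg, ← TensorProduct.comm_algebraMap_map, ← hc, hbr.isDoubleBracket.skew]
  refine ⟨brF, hF, fun a b => ?_, fun brF' hF' hc' => ?_⟩
  · have h := FreeSkewField.biderivation_ext
      (hbr.isDoubleBracket.isBiderivation (glue E) (glue E)) (hF.isBiderivation_id.map (glue E))
      fun α β => by
        simp only [LinearMap.compl₁₂_apply, LinearMap.compr₂_apply, AlgHom.toLinearMap_apply,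
          hFc, hc]
    exact DFunLike.congr_fun (DFunLike.congr_fun h a) b
  · refine FreeSkewField.doubleBracket_ext hF' hF fun α β => ?_
    apply map_glue_injective E
    rw [← hc', hFc, hc]
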